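/- Let $N\ge 1$, $0<\rho\le 1$, $T>0$, and let $\mathbb{T}^N=(-\pi,\pi]^N$; functions on $\mathbb{T}^N$ are identified with functions on $\mathbb{R}^N$ that are $2\pi$-periodic in each variable. For $g\in L_2(\mathbb{T}^N)$ put $g_n=(2\pi)^{-N}\int_{\mathbb{T}^N}g(x)e^{-inx}\,dx$, $n\in\mathbb{Z}^N$, and for $a>0$ let $L_2^a(\mathbb{T}^N)$ be the Sobolev space of all $g\in L_2(\mathbb{T}^N)$ with $\sum_{n}(1+|n|^2)^a|g_n|^2<\infty$. Let $A(D)=\sum_{|\alpha|=m}a_\alpha D^\alpha$, $D_j=-i\,\partial/\partial x_j$, $m\ge 1$, be a homogeneous symmetric positive elliptic operator with constant coefficients, i.e. the $a_\alpha$ are real and $A(\xi)=\sum_{|\alpha|=m}a_\alpha\xi^\alpha>0$ for all $\xi\in\mathbb{R}^N\setminus\{0\}$ (so that $A(D)e^{inx}=A(n)e^{inx}$). For $\sigma>0$ put $\hat A^{\sigma}g=\sum_{n}A(n)^{\sigma}g_ne^{inx}$, a series in $L_2(\mathbb{T}^N)$. Let $\partial_t^{\rho-1}g(t)=\frac{1}{\Gamma(1-\rho)}\int_0^t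 (t-s)^{-\rho}g(s)\,ds$ for $\rho<1$, $\partial_t^{0}g=g$, and let $\partial_t^{\rho}g=\frac{d}{dt}\partial_t^{\rho-1}g$ be the Riemann--Liouville derivative (the derivative at $t=T$ being the left one). Consider the problem $$\partial_t^\rho u(x,t)+A(D)u(x,t)=f(x,t),\quad x\in\mathbb{T}^N,\ 0<t\le T;\qquad \lim_{t\to 0+}\partial_t^{\rho-1}u(x,t)=\varphi(x),\quad x\in\mathbb{T}^N. \tag{1}$$ A solution of (1) is a function $u$, $2\pi$-periodic in each $x_j$ and of class $C^m$ in $x$ for each $t\in(0,T]$, such that $\partial_t^{\rho-1}u$ exists and is continuous on $\mathbb{T}^N\times(0,T]$ with a continuous extension to $\mathbb{T}^N\times[0,T]$, such that $\partial_t^\rho u$ and $A(D)u$ exist and are continuous on $\mathbb{T}^N\times(0,T]$, and such that (1) holds at every point. **Theorem.** Let $\tau>\frac N2$ and $\varphi\in L_2^\tau(\mathbb{T}^N)$. Let $f(\cdot,t)\in L_2^\tau(\mathbb{T}^N)$ for every $t\in[0,T]$, let $F(t)=\hat A^{\tau/m}f(\cdot,t)$ be continuous on $[0,T]$ in the norm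 of $L_2(\mathbb{T}^N)$, and let the mean value $f_0(t)=(2\pi)^{-N}\int_{\mathbb{T}^N}f(x,t)\,dx$ be continuous on $[0,T]$. Then $\varphi$ and all $f(\cdot,t)$, $t\in[0,T]$, have continuous $2\pi$-periodic representatives, and, with these representatives as data, problem (1) has a solution. It has the form $$u(x,t)=\sum_{n\in\mathbb{Z}^N}\Big[\varphi_n t^{\rho-1}E_{\rho,\rho}(-A(n)t^\rho)+\int_0^t f_n(t-\xi)\,\xi^{\rho-1}E_{\rho,\rho}(-A(n)\xi^\rho)\,d\xi\Big]e^{inx},$$ where $\varphi_n$ and $f_n(t)$ are the Fourier coefficients of $\varphi$ and $f(\cdot,t)$ and $E_{\rho,\mu}(z)=\sum_{k=0}^\infty \frac{z^k}{\Gamma(\rho k+\mu)}$ is the Mittag-Leffler function, and for each $t\in(0,T]$ this series converges absolutely and uniformly in $x\in\mathbb{T}^N$. -/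

import Mathlib

namespace TorusSubdiffusion

open MeasureTheory Set Filter Topology

noncomputable section

/-- The fundamental cell `(-π, π]^N` of the torus. -/
def cell (N : ℕ) : Set (Fin N → ℝ) := Set.univ.pi fun _ => Set.Ioc (-Real.pi) Real.pi

/-- Lebesgue measure on the fundamental cell. -/
abbrev torusMeasure (N : ℕ) : Measure (Fin N → ℝ) := volume.restrict (cell N)

instance instIsFiniteMeasureTorus (N : ℕ) : IsFiniteMeasure (torusMeasure N) := by
  refine ⟨?_⟩
  rw [Measure.restrict_apply_univ, cell, Real.volume_pi_Ioc]
  exact ENNReal.prod_lt_top fun i _ => ENNReal.ofReal_lt_top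

/-- The complex Hilbert space `L_2(𝕋^N)`. -/
abbrev L2T (N : ℕ) := Lp ℂ 2 (torusMeasure N)

/-- Functions on `ℝ^N` that are `2π`-periodic in each variable. -/
def IsPeriodic {N : ℕ} (g : (Fin N → ℝ) → ℂ) : Prop :=
  ∀ (j : Fin N) (x : Fin N → ℝ), g (x + Pi.single j (2 * Real.pi)) = g x

/-- The exponential `x ↦ e^{i n x}`. -/
def expFun {N : ℕ} (n : Fin N → ℤ) (x : Fin N → ℝ) : ℂ :=
  Complex.exp (Complex.I * ((∑ j, (n j : ℝ) * x j : ℝ) : ℂ))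

theorem memLp_expFun {N : ℕ} (n : Fin N → ℤ) : MemLp (expFun n) 2 (torusMeasure N) := by
  refine MemLp.of_bound (Continuous.aestronglyMeasurable ?_) 1 (Eventually.of_forall fun x => ?_)
  · unfold expFun; fun_prop
  · rw [expFun, mul_comm, Complex.norm_exp_ofReal_mul_I]

/-- The exponential `e^{i n x}` as an element of `L_2(𝕋^N)`. -/
def expL2 {N : ℕ} (n : Fin N → ℤ) : L2T N := (memLp_expFun n).toLp (expFun n)

/-- The Fourier coefficient `g_n = (2π)^{-N} ∫ g(x) e^{-i n x} dx`, so that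
`g = ∑ g_n e^{i n x}`. -/
def coeff {N : ℕ} (g : L2T N) (n : Fin N → ℤ) : ℂ :=
  (((2 * Real.pi) ^ N : ℝ) : ℂ)⁻¹ * ∫ x, g x * expFun (-n) x ∂(torusMeasure N)

/-- Membership in the Sobolev (Liouville) space `L_2^a(𝕋^N)`. -/
def MemSobolev {N : ℕ} (a : ℝ) (g : L2T N) : Prop :=
  Summable fun n : Fin N → ℤ => (1 + ∑ j, (n j : ℝ) ^ 2) ^ a * ‖coeff g n‖ ^ 2

/-- `A(ξ) = ∑_{|α| = m} a_α ξ^α` is the symbol of a homogeneous symmetric positive elliptic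
operator `A(D)` of order `m` with constant coefficients, where `D_j = -i ∂/∂x_j`. Formal symmetry
of `A(D)` says that the `a_α` are real, and positivity `(A(D) g, g) ≥ 0` follows from ellipticity
`A(ξ) > 0`, `ξ ≠ 0`. -/
structure IsEllipticSymbol {N : ℕ} (A : MvPolynomial (Fin N) ℝ) (m : ℕ) : Prop where
  order_pos : 0 < m
  homogeneous : A.IsHomogeneous m
  elliptic : ∀ ξ : Fin N → ℝ, ξ ≠ 0 → 0 < MvPolynomial.eval ξ A

/-- The value `A(n)` of the symbol at a lattice point. -/
def symbolAt {N : ℕ} (A : MvPolynomial (Fin N) ℝ) (n : Fin N → ℤ) : ℝ :=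
  MvPolynomial.eval (fun j => (n j : ℝ)) A

/-- `D_j = -i ∂/∂x_j`. -/
def partialD {N : ℕ} (j : Fin N) (g : (Fin N → ℝ) → ℂ) : (Fin N → ℝ) → ℂ :=
  fun x => -Complex.I * fderiv ℝ g x (Pi.single j 1)

/-- `D^α = D_1^{α_1} ⋯ D_N^{α_N}`. -/
def multiD {N : ℕ} (α : Fin N →₀ ℕ) (g : (Fin N → ℝ) → ℂ) : (Fin N → ℝ) → ℂ :=
  (List.finRange N).foldr (fun j h => (partialD j)^[α j] h) g

/-- The differential operator `A(D) = ∑_α a_α D^α`. -/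
def diffOp {N : ℕ} (A : MvPolynomial (Fin N) ℝ) (g : (Fin N → ℝ) → ℂ) (x : Fin N → ℝ) : ℂ :=
  ∑ α ∈ A.support, ((A.coeff α : ℝ) : ℂ) * multiD α g x

/-- The power `Â^σ g = ∑_n A(n)^σ g_n e^{i n x}`, a sum in `L_2(𝕋^N)`; it converges exactly for
`g` in the domain of `Â^σ`. -/
def opPow {N : ℕ} (A : MvPolynomial (Fin N) ℝ) (σ : ℝ) (g : L2T N) : L2T N :=
  ∑' n : Fin N → ℤ, (((symbolAt A n ^ σ : ℝ) : ℂ) * coeff g n) • expL2 n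

/-- The Mittag-Leffler function `E_{ρ,μ}` on the real line. -/
def mittagLeffler (ρ μ z : ℝ) : ℝ := ∑' k : ℕ, z ^ k / Real.Gamma (ρ * k + μ)

/-- The Riemann–Liouville integral of order `β ≥ 0` (that is, `∂_t^{-β}`); order `0` is the
identity. -/
def fracInt (β : ℝ) (g : ℝ → ℂ) (t : ℝ) : ℂ :=
  if β = 0 then g t
  else ((Real.Gamma β : ℝ) : ℂ)⁻¹ * ∫ s in (0 : ℝ)..t, (((t - s) ^ (β - 1) : ℝ) : ℂ) * g s

/-- The Riemann–Liouville derivative `∂_t^ρ g = d/dt ∂_t^{ρ-1} g`, `0 < ρ ≤ 1`, of a function on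
`(0, T]`; at `t = T` the derivative is the left one. -/
def fracDeriv (ρ T : ℝ) (g : ℝ → ℂ) (t : ℝ) : ℂ :=
  derivWithin (fracInt (1 - ρ) g) (Set.Ioc 0 T) t

/-- `u` is a regular (classical) solution on `𝕋^N × (0, T]` of `∂_t^ρ u + A(D) u = f`,
`lim_{t → 0} ∂_t^{ρ-1} u = φ`, with `A(D)` of order `m`. -/
structure IsRegularSolution {N : ℕ} (A : MvPolynomial (Fin N) ℝ) (m : ℕ) (ρ T : ℝ)
    (φ : (Fin N → ℝ) → ℂ) (f u : (Fin N → ℝ) → ℝ → ℂ) : Prop where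
  periodic : ∀ t ∈ Set.Ioc 0 T, IsPeriodic fun x => u x t
  /-- the derivatives in `A(D) u` are classical, and `A(D) u ∈ C(𝕋^N × (0, T])` -/
  contDiff : ∀ t ∈ Set.Ioc 0 T, ContDiff ℝ m fun x => u x t
  continuous_diffOp : ContinuousOn
    (fun p : (Fin N → ℝ) × ℝ => diffOp A (fun y => u y p.2) p.1) (Set.univ ×ˢ Set.Ioc 0 T)
  /-- the integral `∂_t^{ρ-1} u` exists -/
  integrable : ρ < 1 → ∀ x, ∀ t ∈ Set.Ioc 0 T,
    IntervalIntegrable (fun s => (((t - s) ^ (1 - ρ - 1) : ℝ) : ℂ) * u x s) volume 0 t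
  /-- `∂_t^{ρ-1} u ∈ C(𝕋^N × [0, T])` -/
  continuous_fracInt : ∃ w : (Fin N → ℝ) × ℝ → ℂ,
    ContinuousOn w (Set.univ ×ˢ Set.Icc 0 T) ∧
      ∀ x, ∀ t ∈ Set.Ioc 0 T, w (x, t) = fracInt (1 - ρ) (u x) t
  /-- `∂_t^ρ u` exists and lies in `C(𝕋^N × (0, T])` -/
  differentiable : ∀ x, DifferentiableOn ℝ (fracInt (1 - ρ) (u x)) (Set.Ioc 0 T)
  continuous_fracDeriv : ContinuousOn
    (fun p : (Fin N → ℝ) × ℝ => fracDeriv ρ T (u p.1) p.2) (Set.univ ×ˢ Set.Ioc 0 T)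
  equation : ∀ x, ∀ t ∈ Set.Ioc 0 T,
    fracDeriv ρ T (u x) t + diffOp A (fun y => u y t) x = f x t
  initial : ∀ x, Tendsto (fracInt (1 - ρ) (u x)) (𝓝[>] 0) (𝓝 (φ x))

/-- The integrand `f_n(t - ξ) ξ^{ρ-1} E_{ρ,ρ}(-A(n) ξ^ρ)`. -/
def duhamelIntegrand {N : ℕ} (A : MvPolynomial (Fin N) ℝ) (ρ : ℝ) (f : ℝ → L2T N)
    (n : Fin N → ℤ) (t ξ : ℝ) : ℂ :=
  coeff (f (t - ξ)) n * ((ξ ^ (ρ - 1) * mittagLeffler ρ ρ (-symbolAt A n * ξ ^ ρ) : ℝ) : ℂ)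

/-- The coefficient
`φ_n t^{ρ-1} E_{ρ,ρ}(-A(n) t^ρ) + ∫_0^t f_n(t - ξ) ξ^{ρ-1} E_{ρ,ρ}(-A(n) ξ^ρ) dξ`. -/
def solCoeff {N : ℕ} (A : MvPolynomial (Fin N) ℝ) (ρ : ℝ) (φ : L2T N) (f : ℝ → L2T N)
    (n : Fin N → ℤ) (t : ℝ) : ℂ :=
  coeff φ n * ((t ^ (ρ - 1) * mittagLeffler ρ ρ (-symbolAt A n * t ^ ρ) : ℝ) : ℂ)
    + ∫ ξ in (0 : ℝ)..t, duhamelIntegrand A ρ f n t ξ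

end

end TorusSubdiffusion

open TorusSubdiffusion

/-!
Mode by mode the problem is the scalar equation `∂_t^ρ y + Λ y = g`, `Λ = A(n) ≥ 0`, solved by
Duhamel's formula with the kernel `e(t) = t^{ρ-1} E_{ρ,ρ}(-Λ t^ρ)`. With `k(t) = t^{ρ-1} / Γ(ρ)` it
satisfies the resolvent equation `e + Λ k * e = k`, and since `k(t₀ - s) / k(t - s)` is decreasing
in `s < t < t₀`, `e` cannot reach zero; hence `0 < e ≤ k`. Multiplying the power series of `e` by
`t` gives a similar equation for `t e(t)`, from which `Λ t e(t) ≤ 1`. Interpolating,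
`Λ e(t) ≤ C Λ^ε t^{ερ-1}`, which is integrable at `0` at the cost of a factor `Λ^ε`.

Choose `ε` with `τ - m ε > N / 2`. Since `A(n) ≥ c |n|^m`, Cauchy–Schwarz against the square
summable `A(n)^{ε-τ/m}`, `n ≠ 0`, bounds the tails of `∑ A(n)^ε |f_n(t)|`, uniformly in `t`, because
`Â^{τ/m} f(·, t)` is bounded in `L_2`. So the series of `A(n) u_n(t) e^{inx}` converges uniformly
on `[δ, T]`, and all operations in the equation may be carried out term by term.
-/

namespace TorusSubdiffusion

open MeasureTheory Set Filter Topology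

noncomputable section

theorem integrable_and_hasSum_integral {α E ι : Type*} [MeasurableSpace α] {μ : Measure α}
    [NormedAddCommGroup E] [NormedSpace ℝ E] [Countable ι]
    {F : ι → α → E} (hF : ∀ i, Integrable (F i) μ) (hs : Summable fun i => ∫ a, ‖F i a‖ ∂μ)
    {g : α → E} (hg : ∀ᵐ a ∂μ, HasSum (fun i => F i a) (g a)) :
    Integrable g μ ∧ HasSum (fun i => ∫ a, F i a ∂μ) (∫ a, g a ∂μ) := by
  have hfin : ∑' i, ∫⁻ a, ‖F i a‖ₑ ∂μ ≠ ⊤ := by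
    have (i : ι) : ∫⁻ a, ‖F i a‖ₑ ∂μ = ‖∫ a, ‖F i a‖ ∂μ‖ₑ := by
      rw [← ofReal_integral_norm_eq_lintegral_enorm (hF i), Real.enorm_eq_ofReal]
      exact integral_nonneg fun a => norm_nonneg _
    simp_rw [this]
    exact tsum_enorm_ne_top_iff_summable_norm.2 (by simpa using hs.abs)
  refine ⟨⟨?_, ?_⟩, ?_⟩
  · exact aestronglyMeasurable_of_tendsto_ae atTop (f := fun (s : Finset ι) a => ∑ i ∈ s, F i a)
      (fun s => by
        simpa using Finset.aestronglyMeasurable_fun_sum s fun i _ => (hF i).aestronglyMeasurable) hg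
  · refine lt_of_le_of_lt (lintegral_mono_ae (g := fun a => ∑' i, ‖F i a‖ₑ) ?_) ?_
    · filter_upwards [hg] with a ha
      rw [← ha.tsum_eq]
      exact enorm_tsum_le_tsum_enorm
    · rw [lintegral_tsum fun i => (hF i).aestronglyMeasurable.enorm]
      exact hfin.lt_top
  · have h := hasSum_integral_of_summable_integral_norm hF hs
    rwa [integral_congr_ae (hg.mono fun a ha => ha.tsum_eq)] at h

theorem intervalIntegral_nonneg_of_Ioc {a b : ℝ} (hab : a ≤ b) {g : ℝ → ℝ}
    (hg : ∀ s ∈ Ioc a b, 0 ≤ g s) : 0 ≤ ∫ s in a..b, g s := by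
  rw [intervalIntegral.integral_of_le hab]
  exact setIntegral_nonneg measurableSet_Ioc hg

/-! ### The Riemann–Liouville kernel -/

/-- The Riemann–Liouville kernel `t ^ (a - 1) / Γ(a)`: convolution with it is the fractional
integral of order `a`. -/
def rlKernel (a t : ℝ) : ℝ := t ^ (a - 1) / Real.Gamma a

theorem rlKernel_one (t : ℝ) : rlKernel 1 t = 1 := by simp [rlKernel]

theorem rlKernel_nonneg {a t : ℝ} (ha : 0 < a) (ht : 0 ≤ t) : 0 ≤ rlKernel a t :=
  div_nonneg (Real.rpow_nonneg ht _) (Real.Gamma_pos_of_pos ha).le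

theorem rlKernel_pos {a t : ℝ} (ha : 0 < a) (ht : 0 < t) : 0 < rlKernel a t :=
  div_pos (Real.rpow_pos_of_pos ht _) (Real.Gamma_pos_of_pos ha)

theorem intervalIntegrable_rlKernel {a : ℝ} (ha : 0 < a) (t : ℝ) :
    IntervalIntegrable (rlKernel a) volume 0 t :=
  (intervalIntegral.intervalIntegrable_rpow' (by linarith)).div_const _

theorem integral_rpow_mul_sub_rpow {a b t : ℝ} (ha : 0 < a) (hb : 0 < b) (ht : 0 < t) :
    ∫ s in (0 : ℝ)..t, s ^ (a - 1) * (t - s) ^ (b - 1)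
      = t ^ (a + b - 1) * (Real.Gamma a * Real.Gamma b / Real.Gamma (a + b)) := by
  have hbeta := Complex.betaIntegral_scaled (a : ℂ) (b : ℂ) ht
  rw [Complex.betaIntegral_eq_Gamma_mul_div _ _ (by simpa using ha) (by simpa using hb)] at hbeta
  have hreal : ∫ x in (0 : ℝ)..t, (x : ℂ) ^ ((a : ℂ) - 1) * ((t : ℂ) - x) ^ ((b : ℂ) - 1)
      = ((∫ x in (0 : ℝ)..t, x ^ (a - 1) * (t - x) ^ (b - 1) : ℝ) : ℂ) := by
    rw [← intervalIntegral.integral_ofReal]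
    refine intervalIntegral.integral_congr fun x hx => ?_
    rw [uIcc_of_le ht.le] at hx
    rw [Complex.ofReal_mul, Complex.ofReal_cpow hx.1, Complex.ofReal_cpow (sub_nonneg.2 hx.2)]
    push_cast
    rfl
  have hpow : ((t ^ (a + b - 1) : ℝ) : ℂ) = (t : ℂ) ^ ((a : ℂ) + b - 1) := by
    rw [Complex.ofReal_cpow ht.le]
    push_cast
    rfl
  rw [hreal, ← hpow, ← Complex.ofReal_add, Complex.Gamma_ofReal, Complex.Gamma_ofReal,
    Complex.Gamma_ofReal] at hbeta
  exact_mod_cast hbeta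

theorem integral_rlKernel_mul_rlKernel {a b t : ℝ} (ha : 0 < a) (hb : 0 < b) (ht : 0 < t) :
    ∫ s in (0 : ℝ)..t, rlKernel b (t - s) * rlKernel a s = rlKernel (a + b) t := by
  have hΓa := (Real.Gamma_pos_of_pos ha).ne'
  have hΓb := (Real.Gamma_pos_of_pos hb).ne'
  calc ∫ s in (0 : ℝ)..t, rlKernel b (t - s) * rlKernel a s
      = ∫ s in (0 : ℝ)..t, (Real.Gamma a * Real.Gamma b)⁻¹ * (s ^ (a - 1) * (t - s) ^ (b - 1)) := by
        refine intervalIntegral.integral_congr fun x _ => ?_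
        simp only [rlKernel]
        field_simp
    _ = rlKernel (a + b) t := by
        rw [intervalIntegral.integral_const_mul, integral_rpow_mul_sub_rpow ha hb ht, rlKernel]
        field_simp

theorem integral_rlKernel {a t : ℝ} (ha : 0 < a) (ht : 0 < t) :
    ∫ s in (0 : ℝ)..t, rlKernel a s = rlKernel (a + 1) t := by
  simpa [rlKernel_one] using integral_rlKernel_mul_rlKernel ha one_pos ht

theorem intervalIntegrable_rlKernel_mul_rlKernel {a b t : ℝ} (ha : 0 < a) (hb : 0 < b)
    (ht : 0 < t) :
    IntervalIntegrable (fun s => rlKernel b (t - s) * rlKernel a s) volume 0 t := by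
  refine intervalIntegral.intervalIntegrable_of_integral_ne_zero ?_
  rw [integral_rlKernel_mul_rlKernel ha hb ht]
  exact (rlKernel_pos (add_pos ha hb) ht).ne'

theorem intervalIntegrable_and_hasSum_integral_rlKernel_mul {a c : ℕ → ℝ} {b t : ℝ}
    (ha : ∀ k, 0 < a k) (hb : 0 < b) (ht : 0 < t)
    (hs : Summable fun k => |c k| * rlKernel (a k + b) t) {g : ℝ → ℝ}
    (hg : ∀ s ∈ Ioc 0 t, HasSum (fun k => c k * rlKernel (a k) s) (g s)) :
    IntervalIntegrable (fun s => rlKernel b (t - s) * g s) volume 0 t ∧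
      HasSum (fun k => c k * rlKernel (a k + b) t)
        (∫ s in (0 : ℝ)..t, rlKernel b (t - s) * g s) := by
  have key := integrable_and_hasSum_integral (μ := volume.restrict (Ioc 0 t))
    (F := fun k s => c k * (rlKernel b (t - s) * rlKernel (a k) s))
    (g := fun s => rlKernel b (t - s) * g s)
    (fun k => ((intervalIntegrable_iff_integrableOn_Ioc_of_le ht.le).1
      (intervalIntegrable_rlKernel_mul_rlKernel (ha k) hb ht)).const_mul (c k)) ?_ ?_
  · rw [intervalIntegrable_iff_integrableOn_Ioc_of_le ht.le, intervalIntegral.integral_of_le ht.le]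
    refine ⟨key.1, key.2.congr_fun fun k => ?_⟩
    rw [integral_const_mul, ← intervalIntegral.integral_of_le ht.le,
      integral_rlKernel_mul_rlKernel (ha k) hb ht]
  · convert hs using 2 with k
    rw [← integral_rlKernel_mul_rlKernel (ha k) hb ht, intervalIntegral.integral_of_le ht.le,
      ← integral_const_mul]
    refine setIntegral_congr_fun measurableSet_Ioc fun s hs => ?_
    simp only [norm_mul, Real.norm_eq_abs]
    rw [abs_of_nonneg (rlKernel_nonneg hb (sub_nonneg.2 hs.2)),
      abs_of_nonneg (rlKernel_nonneg (ha k) hs.1.le)]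
  · refine (ae_restrict_iff' measurableSet_Ioc).2 (Eventually.of_forall fun s hs => ?_)
    exact ((hg s hs).mul_left (rlKernel b (t - s))).congr_fun fun k => by ring

theorem integral_rlKernel_sub_mul_le {a t t₀ M : ℝ} {g : ℝ → ℝ} (ha : 0 < a) (ht : t < t₀)
    (hg : IntervalIntegrable (fun s => rlKernel a (t₀ - s) * g s) volume t t₀)
    (hM : ∀ s ∈ Icc t t₀, g s ≤ M) :
    ∫ s in t..t₀, rlKernel a (t₀ - s) * g s ≤ rlKernel (a + 1) (t₀ - t) * M := by
  have hk : IntervalIntegrable (fun s => rlKernel a (t₀ - s)) volume t t₀ := by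
    simpa using ((intervalIntegrable_rlKernel ha (t₀ - t)).comp_sub_left t₀).symm
  calc ∫ s in t..t₀, rlKernel a (t₀ - s) * g s
      ≤ ∫ s in t..t₀, rlKernel a (t₀ - s) * M :=
        intervalIntegral.integral_mono_on ht.le hg (hk.mul_const M) fun s hs =>
          mul_le_mul_of_nonneg_left (hM s hs) (rlKernel_nonneg ha (sub_nonneg.2 hs.2))
    _ = rlKernel (a + 1) (t₀ - t) * M := by
        rw [intervalIntegral.integral_mul_const,
          intervalIntegral.integral_comp_sub_left (rlKernel a), sub_self,
          integral_rlKernel ha (sub_pos.2 ht)]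

theorem continuousAt_rlKernel {a t : ℝ} (h : t ≠ 0 ∨ 1 ≤ a) : ContinuousAt (rlKernel a) t :=
  (Real.continuousAt_rpow_const t _ (h.imp_right fun h => by linarith)).div_const _

theorem rlKernel_sub_mul_rlKernel_le {a s t t₀ : ℝ} (ha : a ≤ 1) (hs : 0 ≤ s) (hst : s < t)
    (ht : t ≤ t₀) :
    rlKernel a (t₀ - s) * rlKernel a t ≤ rlKernel a (t - s) * rlKernel a t₀ := by
  have h := Real.rpow_le_rpow_of_nonpos (z := a - 1) (by nlinarith : 0 < (t - s) * t₀)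
    (by nlinarith : (t - s) * t₀ ≤ (t₀ - s) * t) (by linarith)
  rw [Real.mul_rpow (by linarith) (by linarith), Real.mul_rpow (by linarith) (by linarith)] at h
  simp only [rlKernel, div_mul_div_comm]
  exact div_le_div_of_nonneg_right h (mul_self_nonneg _)

/-! ### The Mittag-Leffler function -/

theorem rpow_mul_exp_le_Gamma {B x : ℝ} (hB : 0 < B) (hx : 1 ≤ x) :
    B ^ (x - 1) * Real.exp (-(B + 1)) ≤ Real.Gamma x := by
  have hint := Real.GammaIntegral_convergent (by linarith : 0 < x)
  have hsub : Ioc B (B + 1) ⊆ Ioi (0 : ℝ) := fun y hy => hB.trans hy.1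
  rw [Real.Gamma_eq_integral (by linarith)]
  refine le_trans ?_ (setIntegral_mono_set hint ?_ hsub.eventuallyLE)
  · have := setIntegral_ge_of_const_le_real (μ := volume) (c := B ^ (x - 1) * Real.exp (-(B + 1)))
      measurableSet_Ioc (by simp) (fun y (hy : y ∈ Ioc B (B + 1)) => ?_) (hint.mono_set hsub)
    · simpa using this
    · rw [mul_comm]
      gcongr
      · exact hy.2
      · exact hy.1.le
  · exact (ae_restrict_iff' measurableSet_Ioi).2 (Eventually.of_forall fun y (hy : 0 < y) => by
      simp only [Pi.zero_apply]; positivity)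

theorem summable_mittagLeffler {ρ : ℝ} (hρ : 0 < ρ) (μ R : ℝ) :
    Summable fun k : ℕ => R ^ k / Real.Gamma (ρ * k + μ) := by
  -- The lower bound on `Γ` at `B` with `B ^ ρ = Q > |R|` gives a geometric majorant.
  set Q := 2 * |R| + 1
  have hQ : 0 < Q := by positivity
  set B := Q ^ (1 / ρ)
  have hB : 0 < B := Real.rpow_pos_of_pos hQ _
  have hBρ : B ^ ρ = Q := by rw [← Real.rpow_mul hQ.le, one_div_mul_cancel hρ.ne', Real.rpow_one]
  have hlt : |R| / Q < 1 := by
    rw [div_lt_one hQ]; linarith [abs_nonneg R]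
  refine Summable.of_norm_bounded_eventually_nat
    (g := fun k : ℕ => Real.exp (B + 1) * B ^ (1 - μ) * (|R| / Q) ^ k)
    ((summable_geometric_of_lt_one (by positivity) hlt).mul_left _) ?_
  have hlarge : ∀ᶠ k : ℕ in atTop, 1 ≤ ρ * k + μ :=
    (tendsto_atTop_add_const_right _ _
      (tendsto_natCast_atTop_atTop.const_mul_atTop hρ)).eventually_ge_atTop 1
  filter_upwards [hlarge] with k hk
  have hΓ := rpow_mul_exp_le_Gamma hB hk
  have hpos : 0 < B ^ (ρ * k + μ - 1) * Real.exp (-(B + 1)) := by positivity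
  rw [norm_div, norm_pow, Real.norm_eq_abs, Real.norm_eq_abs, abs_of_pos (hpos.trans_le hΓ)]
  refine (div_le_div_of_nonneg_left (by positivity) hpos hΓ).trans (le_of_eq ?_)
  have hpow : B ^ (ρ * k + μ - 1) = Q ^ k / B ^ (1 - μ) := by
    rw [show ρ * k + μ - 1 = ρ * k - (1 - μ) by ring, Real.rpow_sub hB, Real.rpow_mul hB.le,
      hBρ, Real.rpow_natCast]
  rw [hpow, div_pow, Real.exp_neg]
  field_simp

theorem differentiable_mittagLeffler {ρ : ℝ} (hρ : 0 < ρ) (μ : ℝ) :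
    Differentiable ℝ (mittagLeffler ρ μ) := by
  intro x
  set G : ℂ → ℂ := fun z => ∑' k : ℕ, z ^ k / (Real.Gamma (ρ * k + μ) : ℂ) with hG
  have hd : DifferentiableOn ℂ G (Metric.ball 0 (|x| + 1)) := by
    refine Complex.differentiableOn_tsum_of_summable_norm
      (u := fun k : ℕ => |(|x| + 1) ^ k / Real.Gamma (ρ * k + μ)|)
      (summable_mittagLeffler hρ μ (|x| + 1)).abs (fun k => by fun_prop) Metric.isOpen_ball
      fun k w hw => ?_
    have hw' : ‖w‖ ≤ |x| + 1 := (mem_ball_zero_iff.1 hw).le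
    rw [norm_div, norm_pow, Complex.norm_real, Real.norm_eq_abs, abs_div, abs_pow,
      abs_of_nonneg (by positivity : 0 ≤ |x| + 1)]
    gcongr
  have hx : DifferentiableAt ℂ G (x : ℂ) :=
    hd.differentiableAt (Metric.isOpen_ball.mem_nhds (by simp))
  have hre : (fun y : ℝ => (G y).re) = mittagLeffler ρ μ := by
    ext y
    have : G y = ((mittagLeffler ρ μ y : ℝ) : ℂ) := by
      simp only [hG, mittagLeffler]
      push_cast
      rfl
    rw [this, Complex.ofReal_re]
  exact hre ▸ hx.hasDerivAt.real_of_complex.differentiableAt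

theorem mittagLeffler_apply_zero (ρ μ : ℝ) : mittagLeffler ρ μ 0 = (Real.Gamma μ)⁻¹ := by
  rw [mittagLeffler, tsum_eq_single 0 fun k hk => by simp [hk]]
  simp

/-! ### The relaxation kernel and the relaxation function -/

/-- The kernel `t ^ (ρ - 1) E_{ρ,ρ}(-Λ t ^ ρ)` of the resolvent of the fractional relaxation
equation `∂_t^ρ u + Λ u = f`. -/
def mlKernel (ρ Λ t : ℝ) : ℝ := t ^ (ρ - 1) * mittagLeffler ρ ρ (-Λ * t ^ ρ)

/-- The relaxation function `E_{ρ,1}(-Λ t ^ ρ)`: it is the fractional integral of order `1 - ρ` of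
`mlKernel ρ Λ`. -/
def mlRelax (ρ Λ t : ℝ) : ℝ := mittagLeffler ρ 1 (-Λ * t ^ ρ)

theorem mlKernel_one (Λ : ℝ) : mlKernel 1 Λ = mlRelax 1 Λ := by
  ext s
  simp [mlKernel, mlRelax]

section Series

variable {ρ : ℝ} (hρ : 0 < ρ) (Λ : ℝ) {t : ℝ} (ht : 0 < t)

include ht in
theorem pow_mul_rlKernel (b : ℝ) (k : ℕ) :
    Λ ^ k * rlKernel (ρ * k + b) t
      = t ^ (b - 1) * ((Λ * t ^ ρ) ^ k / Real.Gamma (ρ * k + b)) := by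
  rw [rlKernel, show ρ * k + b - 1 = ρ * k + (b - 1) by ring, Real.rpow_add ht, Real.rpow_mul ht.le,
    Real.rpow_natCast, mul_pow]
  ring

include hρ

theorem continuous_mittagLeffler_mul_rpow (μ : ℝ) :
    Continuous fun t : ℝ => mittagLeffler ρ μ (-Λ * t ^ ρ) :=
  (differentiable_mittagLeffler hρ μ).continuous.comp
    (continuous_const.mul (Real.continuous_rpow_const hρ.le))

theorem continuous_mlRelax : Continuous (mlRelax ρ Λ) :=
  continuous_mittagLeffler_mul_rpow hρ Λ 1

theorem mlRelax_zero : mlRelax ρ Λ 0 = 1 := by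
  rw [mlRelax, Real.zero_rpow hρ.ne', mul_zero, mittagLeffler_apply_zero, Real.Gamma_one, inv_one]

theorem differentiableOn_mlKernel : DifferentiableOn ℝ (mlKernel ρ Λ) (Ioi 0) := fun t ht => by
  have hpow (b : ℝ) : DifferentiableAt ℝ (fun t : ℝ => t ^ b) t :=
    Real.differentiableAt_rpow_const_of_ne _ (ne_of_gt ht)
  have hml : DifferentiableAt ℝ (fun t : ℝ => mittagLeffler ρ ρ (-Λ * t ^ ρ)) t :=
    (differentiable_mittagLeffler hρ ρ _).comp t ((hpow ρ).const_mul (-Λ))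
  exact ((hpow (ρ - 1)).mul hml).differentiableWithinAt

include ht

theorem hasSum_rlKernel (b : ℝ) :
    HasSum (fun k : ℕ => (-Λ) ^ k * rlKernel (ρ * k + b) t)
      (t ^ (b - 1) * mittagLeffler ρ b (-Λ * t ^ ρ)) :=
  ((summable_mittagLeffler hρ b (-Λ * t ^ ρ)).hasSum.mul_left _).congr_fun
    fun k => pow_mul_rlKernel (-Λ) ht b k

theorem hasSum_mlKernel :
    HasSum (fun k : ℕ => (-Λ) ^ k * rlKernel (ρ * k + ρ) t) (mlKernel ρ Λ t) :=
  hasSum_rlKernel hρ Λ ht ρ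

theorem hasSum_mlRelax :
    HasSum (fun k : ℕ => (-Λ) ^ k * rlKernel (ρ * k + 1) t) (mlRelax ρ Λ t) := by
  simpa [mlRelax] using hasSum_rlKernel hρ Λ ht 1

theorem hasSum_mul_mlKernel :
    HasSum (fun k : ℕ => (-Λ) ^ k * (k + 1) * rlKernel (ρ * k + (ρ + 1)) t)
      (ρ⁻¹ * (t * mlKernel ρ Λ t)) := by
  rw [← mul_assoc]
  refine ((hasSum_mlKernel hρ Λ ht).mul_left (ρ⁻¹ * t)).congr_fun fun k => ?_
  have hk : 0 < ρ * k + ρ := by positivity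
  have := (Real.Gamma_pos_of_pos hk).ne'
  rw [rlKernel, rlKernel, show ρ * k + (ρ + 1) = ρ * k + ρ + 1 by ring, Real.Gamma_add_one hk.ne',
    add_sub_cancel_right, Real.rpow_sub_one ht.ne']
  field_simp

theorem summable_abs_mul_rlKernel {b : ℝ} (hb : 0 < b) :
    Summable fun k : ℕ => |(-Λ) ^ k * (k + 1)| * rlKernel (ρ * k + b) t := by
  refine Summable.of_nonneg_of_le
    (fun k => mul_nonneg (abs_nonneg _) (rlKernel_nonneg (by positivity) ht.le)) (fun k => ?_)
    ((summable_mittagLeffler hρ b (2 * |Λ| * t ^ ρ)).mul_left (t ^ (b - 1)))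
  rw [← pow_mul_rlKernel _ ht]
  refine mul_le_mul_of_nonneg_right ?_ (rlKernel_nonneg (by positivity) ht.le)
  rw [abs_mul, abs_pow, abs_neg, mul_pow, mul_comm, abs_of_nonneg (by positivity)]
  refine mul_le_mul_of_nonneg_right ?_ (by positivity)
  exact_mod_cast Nat.lt_two_pow_self

theorem summable_abs_rlKernel {b : ℝ} (hb : 0 < b) :
    Summable fun k : ℕ => |(-Λ) ^ k| * rlKernel (ρ * k + b) t := by
  refine Summable.of_nonneg_of_le
    (fun k => mul_nonneg (abs_nonneg _) (rlKernel_nonneg (by positivity) ht.le)) (fun k => ?_)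
    (summable_abs_mul_rlKernel hρ Λ ht hb)
  refine mul_le_mul_of_nonneg_right ?_ (rlKernel_nonneg (by positivity) ht.le)
  rw [abs_mul]
  refine le_mul_of_one_le_right (abs_nonneg _) ?_
  rw [abs_of_nonneg (by positivity)]
  simp

theorem intervalIntegrable_and_hasSum_integral_rlKernel_mul_mlKernel {b : ℝ} (hb : 0 < b) :
    IntervalIntegrable (fun s => rlKernel b (t - s) * mlKernel ρ Λ s) volume 0 t ∧
      HasSum (fun k : ℕ => (-Λ) ^ k * rlKernel (ρ * k + ρ + b) t)
        (∫ s in (0 : ℝ)..t, rlKernel b (t - s) * mlKernel ρ Λ s) := by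
  refine intervalIntegrable_and_hasSum_integral_rlKernel_mul (a := fun k : ℕ => ρ * k + ρ)
    (fun k => by positivity) hb ht ?_ fun s hs => hasSum_mlKernel hρ Λ hs.1
  simpa only [add_assoc] using summable_abs_rlKernel hρ Λ ht (add_pos hρ hb)

theorem integral_rlKernel_mul_mlKernel (hρ₁ : ρ < 1) :
    ∫ s in (0 : ℝ)..t, rlKernel (1 - ρ) (t - s) * mlKernel ρ Λ s = mlRelax ρ Λ t := by
  refine (intervalIntegrable_and_hasSum_integral_rlKernel_mul_mlKernel hρ Λ ht
    (sub_pos.2 hρ₁)).2.unique ?_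
  refine (hasSum_mlRelax hρ Λ ht).congr_fun fun k => ?_
  rw [show ρ * k + ρ + (1 - ρ) = ρ * k + 1 by ring]

theorem intervalIntegrable_mlKernel : IntervalIntegrable (mlKernel ρ Λ) volume 0 t := by
  simpa [rlKernel_one] using
    (intervalIntegrable_and_hasSum_integral_rlKernel_mul_mlKernel hρ Λ ht one_pos).1

theorem hasSum_integral_mlKernel :
    HasSum (fun k : ℕ => (-Λ) ^ k * rlKernel (ρ * k + ρ + 1) t)
      (∫ s in (0 : ℝ)..t, mlKernel ρ Λ s) := by
  simpa [rlKernel_one] using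
    (intervalIntegrable_and_hasSum_integral_rlKernel_mul_mlKernel hρ Λ ht one_pos).2

theorem mlRelax_eq_one_sub_integral :
    mlRelax ρ Λ t = 1 - Λ * ∫ s in (0 : ℝ)..t, mlKernel ρ Λ s := by
  have hshift := (hasSum_nat_add_iff (f := fun k : ℕ => (-Λ) ^ k * rlKernel (ρ * k + 1) t) 1).1
    (((hasSum_integral_mlKernel hρ Λ ht).mul_left (-Λ)).congr_fun fun k => ?_)
  · rw [(hasSum_mlRelax hρ Λ ht).unique hshift]
    simp only [Finset.sum_range_one, pow_zero, Nat.cast_zero, mul_zero, zero_add, rlKernel_one]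
    ring
  · push_cast
    rw [show ρ * ((k : ℝ) + 1) + 1 = ρ * k + ρ + 1 by ring]
    ring

theorem mlKernel_add_integral :
    mlKernel ρ Λ t + Λ * ∫ s in (0 : ℝ)..t, rlKernel ρ (t - s) * mlKernel ρ Λ s
      = rlKernel ρ t := by
  have hshift := (hasSum_nat_add_iff (f := fun k : ℕ => (-Λ) ^ k * rlKernel (ρ * k + ρ) t) 1).1
    (((intervalIntegrable_and_hasSum_integral_rlKernel_mul_mlKernel hρ Λ ht hρ).2.mul_left
      (-Λ)).congr_fun fun k => ?_)
  · rw [← hshift.unique (hasSum_mlKernel hρ Λ ht)]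
    simp
  · push_cast
    rw [show ρ * ((k : ℝ) + 1) + ρ = ρ * k + ρ + ρ by ring]
    ring

theorem mul_mlKernel_add_integral :
    t * mlKernel ρ Λ t + Λ * ∫ s in (0 : ℝ)..t, rlKernel ρ (t - s) * (s * mlKernel ρ Λ s)
      = ρ * ∫ s in (0 : ℝ)..t, mlKernel ρ Λ s := by
  have hconv := (intervalIntegrable_and_hasSum_integral_rlKernel_mul
    (a := fun k : ℕ => ρ * k + (ρ + 1)) (fun k => by positivity) hρ ht
    (by simpa only [add_assoc] using
      summable_abs_mul_rlKernel hρ Λ ht (by positivity : 0 < ρ + (1 + ρ)))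
    fun s hs => hasSum_mul_mlKernel hρ Λ hs.1).2
  have hshift := (hasSum_nat_add_iff
    (f := fun k : ℕ => (-Λ) ^ k * k * rlKernel (ρ * k + (ρ + 1)) t) 1).1
    ((hconv.mul_left (-Λ)).congr_fun fun k => by
      push_cast
      rw [show ρ * ((k : ℝ) + 1) + (ρ + 1) = ρ * k + (ρ + 1) + ρ by ring]
      ring)
  have hsub := ((hasSum_mul_mlKernel hρ Λ ht).sub hshift).unique
    ((hasSum_integral_mlKernel hρ Λ ht).congr_fun fun k => by rw [← add_assoc]; ring)
  have hconst : ∫ s in (0 : ℝ)..t, rlKernel ρ (t - s) * (ρ⁻¹ * (s * mlKernel ρ Λ s))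
      = ρ⁻¹ * ∫ s in (0 : ℝ)..t, rlKernel ρ (t - s) * (s * mlKernel ρ Λ s) := by
    simp only [mul_left_comm _ ρ⁻¹, intervalIntegral.integral_const_mul]
  rw [← hsub, hconst]
  field_simp
  simp

theorem hasDerivAt_mlRelax : HasDerivAt (mlRelax ρ Λ) (-Λ * mlKernel ρ Λ t) t := by
  have hd := differentiableOn_mlKernel hρ Λ
  have hint : HasDerivAt (fun t => ∫ s in (0 : ℝ)..t, mlKernel ρ Λ s) (mlKernel ρ Λ t) t :=
    intervalIntegral.integral_hasDerivAt_right (intervalIntegrable_mlKernel hρ Λ ht)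
      (hd.continuousOn.stronglyMeasurableAtFilter isOpen_Ioi t ht)
      (hd.differentiableAt (Ioi_mem_nhds ht)).continuousAt
  refine (((hint.const_mul Λ).const_sub 1).congr_deriv (by ring)).congr_of_eventuallyEq ?_
  filter_upwards [Ioi_mem_nhds ht] with s hs
  exact mlRelax_eq_one_sub_integral hρ Λ hs

end Series

/-! ### Positivity and bounds -/

section Positivity

variable {ρ Λ : ℝ} (hρ : 0 < ρ) (hρ₁ : ρ ≤ 1) (hΛ : 0 ≤ Λ)

include hρ hρ₁ hΛ

omit hρ₁ hΛ in
theorem intervalIntegrable_rlKernel_mul_mlKernel {a b r : ℝ} (hr : 0 < r) (ha : a ∈ Icc 0 r)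
    (hb : b ∈ Icc 0 r) :
    IntervalIntegrable (fun s => rlKernel ρ (r - s) * mlKernel ρ Λ s) volume a b :=
  (intervalIntegrable_and_hasSum_integral_rlKernel_mul_mlKernel hρ Λ hr hρ).1.mono_set
    (uIcc_of_le hr.le ▸ uIcc_subset_Icc ha hb)

theorem mlKernel_mul_rlKernel_le {t t₀ : ℝ} (ht : 0 < t) (htt₀ : t ≤ t₀)
    (hpos : ∀ s ∈ Ioo 0 t, 0 ≤ mlKernel ρ Λ s) (hneg : mlKernel ρ Λ t₀ ≤ 0) :
    mlKernel ρ Λ t * rlKernel ρ t₀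
      ≤ rlKernel ρ t * (Λ * ∫ s in t..t₀, rlKernel ρ (t₀ - s) * mlKernel ρ Λ s) := by
  have ht₀ := ht.trans_le htt₀
  have hint₁ := intervalIntegrable_rlKernel_mul_mlKernel (Λ := Λ) hρ ht₀ ⟨le_rfl, ht₀.le⟩
    ⟨ht.le, htt₀⟩
  have hint₂ := intervalIntegrable_rlKernel_mul_mlKernel (Λ := Λ) hρ ht₀ ⟨ht.le, htt₀⟩
    ⟨ht₀.le, le_rfl⟩
  have hint := intervalIntegrable_rlKernel_mul_mlKernel (Λ := Λ) hρ ht ⟨le_rfl, ht.le⟩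
    ⟨ht.le, le_rfl⟩
  have hmono : rlKernel ρ t * ∫ s in (0 : ℝ)..t, rlKernel ρ (t₀ - s) * mlKernel ρ Λ s
      ≤ rlKernel ρ t₀ * ∫ s in (0 : ℝ)..t, rlKernel ρ (t - s) * mlKernel ρ Λ s := by
    rw [← intervalIntegral.integral_const_mul, ← intervalIntegral.integral_const_mul]
    refine intervalIntegral.integral_mono_on_of_le_Ioo ht.le (hint₁.const_mul _)
      (hint.const_mul _) fun s hs => ?_
    have := mul_le_mul_of_nonneg_right
      (rlKernel_sub_mul_rlKernel_le hρ₁ hs.1.le hs.2 htt₀) (hpos s hs)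
    linarith
  have hres := mlKernel_add_integral hρ Λ ht
  have hres₀ := mlKernel_add_integral hρ Λ ht₀
  rw [← intervalIntegral.integral_add_adjacent_intervals hint₁ hint₂] at hres₀
  have hmulΛ := mul_le_mul_of_nonneg_left hmono hΛ
  have hmulneg := mul_nonpos_of_nonneg_of_nonpos (rlKernel_nonneg hρ ht.le) hneg
  linear_combination hmulΛ + hmulneg + rlKernel ρ t₀ * hres - rlKernel ρ t * hres₀

omit hρ₁ hΛ in
theorem exists_isLeast_mlKernel_nonpos {t : ℝ} (ht : 0 < t) (hneg : mlKernel ρ Λ t ≤ 0) :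
    ∃ t₀, IsLeast {s | 0 < s ∧ mlKernel ρ Λ s ≤ 0} t₀ := by
  set g : ℝ → ℝ := fun s => mittagLeffler ρ ρ (-Λ * s ^ ρ)
  have hg : Continuous g := continuous_mittagLeffler_mul_rpow hρ Λ ρ
  have hg₀ : 0 < g 0 := by
    simp only [g, Real.zero_rpow hρ.ne', mul_zero, mittagLeffler_apply_zero]
    exact inv_pos.2 (Real.Gamma_pos_of_pos hρ)
  have hiff {s : ℝ} (hs : 0 < s) : mlKernel ρ Λ s ≤ 0 ↔ g s ≤ 0 :=
    by rw [← not_lt, ← not_lt, mlKernel, mul_pos_iff_of_pos_left (Real.rpow_pos_of_pos hs _)]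
  have hcompact : IsCompact (Icc 0 t ∩ {s | g s ≤ 0}) :=
    isCompact_Icc.inter_right (isClosed_le hg continuous_const)
  obtain ⟨t₀, ⟨⟨ht₀, ht₀t⟩, hgt₀⟩, hleast⟩ :=
    hcompact.exists_isLeast ⟨t, ⟨ht.le, le_rfl⟩, (hiff ht).1 hneg⟩
  have hpos : 0 < t₀ := ht₀.lt_of_ne (by rintro rfl; exact hg₀.not_ge hgt₀)
  refine ⟨t₀, ⟨hpos, (hiff hpos).2 hgt₀⟩, fun s hs => ?_⟩
  rcases le_total s t with hst | hts
  · exact hleast ⟨⟨hs.1.le, hst⟩, (hiff hs.1).1 hs.2⟩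
  · exact ht₀t.trans hts

theorem mlKernel_pos {t : ℝ} (ht : 0 < t) : 0 < mlKernel ρ Λ t := by
  -- At the first zero `t₀` of the kernel, `mlKernel_mul_rlKernel_le` is contradicted at a point
  -- `t` close to `t₀` where the kernel is maximal on a short interval ending at `t₀`.
  by_contra! hneg
  obtain ⟨t₀, ⟨ht₀, hneg₀⟩, hleast⟩ := exists_isLeast_mlKernel_nonpos hρ ht hneg
  have hpos : ∀ s ∈ Ioo 0 t₀, 0 < mlKernel ρ Λ s := fun s hs =>
    lt_of_not_ge fun h => (hleast ⟨hs.1, h⟩).not_gt hs.2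
  have hsmall : ∀ᶠ s in 𝓝 t₀, rlKernel ρ s * (Λ * rlKernel (ρ + 1) (t₀ - s)) < rlKernel ρ t₀ := by
    refine ContinuousAt.eventually_lt ?_ continuousAt_const ?_
    · refine (continuousAt_rlKernel (.inl ht₀.ne')).mul (continuousAt_const.mul ?_)
      exact ContinuousAt.comp (g := rlKernel (ρ + 1))
        (continuousAt_rlKernel (.inr (by linarith))) (by fun_prop)
    · simpa [rlKernel, Real.zero_rpow hρ.ne'] using rlKernel_pos hρ ht₀
  obtain ⟨l, ⟨hl, hlt₀⟩, hsub⟩ := exists_Ioc_subset_of_mem_nhds' hsmall ht₀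
  obtain ⟨t₁, hlt₁, ht₁⟩ := exists_between hlt₀
  have ht₁pos : 0 < t₁ := hl.trans_lt hlt₁
  obtain ⟨r, hr, hmax⟩ := isCompact_Icc.exists_isMaxOn (nonempty_Icc.2 ht₁.le)
    ((differentiableOn_mlKernel hρ Λ).continuousOn.mono fun s hs => ht₁pos.trans_le hs.1)
  have hrpos : 0 < r := ht₁pos.trans_le hr.1
  have her : 0 < mlKernel ρ Λ r :=
    (hpos t₁ ⟨ht₁pos, ht₁⟩).trans_le (hmax (left_mem_Icc.2 ht₁.le))
  have hrt₀ : r < t₀ := hr.2.lt_of_ne (by rintro rfl; exact hneg₀.not_gt her)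
  have hle := mlKernel_mul_rlKernel_le hρ hρ₁ hΛ hrpos hrt₀.le
    (fun s hs => (hpos s ⟨hs.1, hs.2.trans hrt₀⟩).le) hneg₀
  have hint := integral_rlKernel_sub_mul_le hρ hrt₀
    (intervalIntegrable_rlKernel_mul_mlKernel hρ ht₀ ⟨hrpos.le, hrt₀.le⟩ ⟨ht₀.le, le_rfl⟩)
    fun s hs => hmax ⟨hr.1.trans hs.1, hs.2⟩
  have hlt := mul_lt_mul_of_pos_left (hsub ⟨hlt₁.trans_le hr.1, hrt₀.le⟩) her
  have hbound := mul_le_mul_of_nonneg_left (mul_le_mul_of_nonneg_left hint hΛ)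
    (rlKernel_nonneg hρ hrpos.le)
  linarith

end Positivity

section Bounds

variable {ρ Λ t : ℝ} (hρ : 0 < ρ) (hρ₁ : ρ ≤ 1) (hΛ : 0 ≤ Λ)

include hρ hρ₁ hΛ

theorem integral_mlKernel_nonneg (ht : 0 ≤ t) : 0 ≤ ∫ s in (0 : ℝ)..t, mlKernel ρ Λ s :=
  intervalIntegral_nonneg_of_Ioc ht fun _ hs => (mlKernel_pos hρ hρ₁ hΛ hs.1).le

theorem mlRelax_nonneg (ht : 0 ≤ t) : 0 ≤ mlRelax ρ Λ t := by
  rcases ht.eq_or_lt with rfl | ht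
  · rw [mlRelax_zero hρ]
    exact zero_le_one
  rcases hρ₁.lt_or_eq with h | rfl
  · rw [← integral_rlKernel_mul_mlKernel hρ Λ ht h]
    exact intervalIntegral_nonneg_of_Ioc ht.le fun s hs =>
      mul_nonneg (rlKernel_nonneg (sub_pos.2 h) (sub_nonneg.2 hs.2))
        (mlKernel_pos hρ hρ₁ hΛ hs.1).le
  · rw [← mlKernel_one]
    exact (mlKernel_pos one_pos le_rfl hΛ ht).le

theorem mlRelax_le_one (ht : 0 ≤ t) : mlRelax ρ Λ t ≤ 1 := by
  rcases ht.eq_or_lt with rfl | ht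
  · rw [mlRelax_zero hρ]
  · rw [mlRelax_eq_one_sub_integral hρ Λ ht]
    linarith [mul_nonneg hΛ (integral_mlKernel_nonneg hρ hρ₁ hΛ ht.le)]

theorem norm_mlRelax_le_one (ht : 0 ≤ t) : ‖mlRelax ρ Λ t‖ ≤ 1 :=
  (Real.norm_of_nonneg (mlRelax_nonneg hρ hρ₁ hΛ ht)).trans_le (mlRelax_le_one hρ hρ₁ hΛ ht)

variable (ht : 0 < t)

include ht

theorem mlKernel_le_rlKernel : mlKernel ρ Λ t ≤ rlKernel ρ t := by
  rw [← mlKernel_add_integral hρ Λ ht]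
  refine le_add_of_nonneg_right (mul_nonneg hΛ
    (intervalIntegral_nonneg_of_Ioc ht.le fun s hs => ?_))
  exact mul_nonneg (rlKernel_nonneg hρ (sub_nonneg.2 hs.2)) (mlKernel_pos hρ hρ₁ hΛ hs.1).le

theorem mul_mul_mlKernel_le_one : Λ * (t * mlKernel ρ Λ t) ≤ 1 := by
  have hle : t * mlKernel ρ Λ t ≤ ρ * ∫ s in (0 : ℝ)..t, mlKernel ρ Λ s := by
    rw [← mul_mlKernel_add_integral hρ Λ ht]
    refine le_add_of_nonneg_right (mul_nonneg hΛ
      (intervalIntegral_nonneg_of_Ioc ht.le fun s hs => ?_))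
    exact mul_nonneg (rlKernel_nonneg hρ (sub_nonneg.2 hs.2))
      (mul_nonneg hs.1.le (mlKernel_pos hρ hρ₁ hΛ hs.1).le)
  have hint : Λ * ∫ s in (0 : ℝ)..t, mlKernel ρ Λ s ≤ 1 := by
    linarith [mlRelax_eq_one_sub_integral hρ Λ ht, mlRelax_nonneg hρ hρ₁ hΛ ht.le]
  linarith [mul_le_mul_of_nonneg_left hle hΛ, mul_le_mul_of_nonneg_left hint hρ.le]

-- Interpolates between `mul_mul_mlKernel_le_one` and `mlKernel_le_rlKernel`.
theorem rpow_mul_mlKernel_le {ε : ℝ} (hε : 0 < ε) (hε₁ : ε < 1) :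
    Λ ^ (1 - ε) * mlKernel ρ Λ t ≤ (Real.Gamma ρ)⁻¹ ^ ε * t ^ (ε * ρ - 1) := by
  have hpos := mlKernel_pos hρ hρ₁ hΛ ht
  have hdecay : (Λ * (t * mlKernel ρ Λ t)) ^ (1 - ε) ≤ 1 :=
    Real.rpow_le_one (by positivity) (mul_mul_mlKernel_le_one hρ hρ₁ hΛ ht) (by linarith)
  have hk : rlKernel ρ t = (Real.Gamma ρ)⁻¹ * t ^ (ρ - 1) := by
    rw [rlKernel, div_eq_inv_mul]
  have hΓ : 0 ≤ (Real.Gamma ρ)⁻¹ := inv_nonneg.2 (Real.Gamma_pos_of_pos hρ).le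
  have ht_cancel : t ^ (1 - ε) * t ^ (-(1 - ε)) = 1 := by
    rw [← Real.rpow_add ht, add_neg_cancel, Real.rpow_zero]
  have hsplit : mlKernel ρ Λ t = mlKernel ρ Λ t ^ (1 - ε) * mlKernel ρ Λ t ^ ε := by
    rw [← Real.rpow_add hpos, sub_add_cancel, Real.rpow_one]
  calc Λ ^ (1 - ε) * mlKernel ρ Λ t
      = (Λ * (t * mlKernel ρ Λ t)) ^ (1 - ε) * t ^ (-(1 - ε)) * mlKernel ρ Λ t ^ ε := by
        rw [Real.mul_rpow hΛ (by positivity), Real.mul_rpow ht.le hpos.le]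
        nth_rewrite 1 [hsplit]
        linear_combination
          (-(Λ ^ (1 - ε) * mlKernel ρ Λ t ^ (1 - ε) * mlKernel ρ Λ t ^ ε)) * ht_cancel
    _ ≤ 1 * t ^ (-(1 - ε)) * rlKernel ρ t ^ ε := by
        gcongr
        exact mlKernel_le_rlKernel hρ hρ₁ hΛ ht
    _ = (Real.Gamma ρ)⁻¹ ^ ε * t ^ (ε * ρ - 1) := by
        rw [hk, Real.mul_rpow hΓ (by positivity), ← Real.rpow_mul ht.le, one_mul, mul_left_comm,
          ← Real.rpow_add ht]
        ring_nf

end Bounds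

/-! ### Causal convolution -/

theorem integrable_indicator_Ioc {E : Type*} [NormedAddCommGroup E] {g : ℝ → E} {t : ℝ}
    (ht : 0 ≤ t) (hg : IntervalIntegrable g volume 0 t) : Integrable (indicator (Ioc 0 t) g) :=
  (integrable_indicator_iff measurableSet_Ioc).2
    ((intervalIntegrable_iff_integrableOn_Ioc_of_le ht).1 hg)

theorem intervalIntegrable_zero_of_le {E : Type*} [NormedAddCommGroup E] {g : ℝ → E} {t T : ℝ}
    (hg : IntervalIntegrable g volume 0 T) (ht : t ∈ Icc 0 T) : IntervalIntegrable g volume 0 t :=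
  hg.mono_set (uIcc_subset_uIcc_left (by rwa [uIcc_of_le (ht.1.trans ht.2)]))

section CausalConv

variable {E : Type*} [NormedAddCommGroup E] [NormedSpace ℝ E] {κ : ℝ → ℝ} {f : ℝ → E} {t T : ℝ}

/-- The causal convolution `∫_0^t κ(ξ) f(t - ξ) dξ` of a scalar kernel with a vector-valued
function; it expresses both fractional integrals and the Duhamel integral. -/
def causalConv (κ : ℝ → ℝ) (f : ℝ → E) (t : ℝ) : E := ∫ ξ in (0 : ℝ)..t, κ ξ • f (t - ξ)

theorem integral_comp_sub_smul (κ : ℝ → ℝ) (f : ℝ → E) (t : ℝ) :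
    ∫ s in (0 : ℝ)..t, κ (t - s) • f s = causalConv κ f t := by
  simpa [causalConv] using
    intervalIntegral.integral_comp_sub_left (fun s => κ s • f (t - s)) t (a := 0) (b := t)

theorem causalConv_one (f : ℝ → E) (t : ℝ) :
    causalConv (fun _ => 1) f t = ∫ s in (0 : ℝ)..t, f s := by
  simp [← integral_comp_sub_smul]

theorem norm_causalConv_le (κ : ℝ → ℝ) (f : ℝ → E) (ht : 0 ≤ t) :
    ‖causalConv κ f t‖ ≤ ∫ ξ in (0 : ℝ)..t, |κ ξ| * ‖f (t - ξ)‖ := by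
  simpa [causalConv, norm_smul] using intervalIntegral.norm_integral_le_integral_norm (μ := volume)
    (f := fun ξ => κ ξ • f (t - ξ)) ht

theorem norm_causalConv_le_of_nonneg (f : ℝ → E) (hκ : ∀ ξ ∈ Ioc 0 t, 0 ≤ κ ξ) (ht : 0 ≤ t) :
    ‖causalConv κ f t‖ ≤ causalConv κ (fun s => ‖f s‖) t := by
  refine (norm_causalConv_le κ f ht).trans_eq
    (intervalIntegral.integral_congr_ae (Eventually.of_forall fun ξ hξ => ?_))
  rw [uIoc_of_le ht] at hξ
  rw [abs_of_nonneg (hκ ξ hξ), smul_eq_mul]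

theorem intervalIntegrable_smul_comp_sub {s : ℝ} (hκ : IntervalIntegrable κ volume 0 t)
    (hf : Continuous f) : IntervalIntegrable (fun ξ => κ ξ • f (s - ξ)) volume 0 t :=
  hκ.smul_continuousOn (hf.comp (continuous_const.sub continuous_id)).continuousOn

theorem convolution_indicator_left (κ : ℝ → ℝ) (f : ℝ → E) (ht : 0 ≤ t) :
    convolution (indicator (Ioc 0 t) κ) f (ContinuousLinearMap.lsmul ℝ ℝ) volume t
      = causalConv κ f t := by
  rw [convolution, causalConv, intervalIntegral.integral_of_le ht,
    ← integral_indicator measurableSet_Ioc]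
  congr 1 with x
  by_cases hx : x ∈ Ioc 0 t <;> simp [hx]

theorem convolution_indicator_right (κ : ℝ → ℝ) (f : ℝ → E) (ht : 0 ≤ t) :
    convolution κ (indicator (Ioc 0 t) f) (ContinuousLinearMap.lsmul ℝ ℝ) volume t
      = causalConv κ f t := by
  rw [convolution, ← integral_sub_left_eq_self _ _ t, ← integral_comp_sub_smul,
    intervalIntegral.integral_of_le ht, ← integral_indicator measurableSet_Ioc]
  congr 1 with x
  by_cases hx : x ∈ Ioc 0 t <;> simp [hx]

theorem convolution_indicator_indicator (κ : ℝ → ℝ) (f : ℝ → E) {s : ℝ} (hs : 0 ≤ s)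
    (hst : s ≤ t) :
    convolution (indicator (Ioc 0 t) κ) (indicator (Ioc 0 t) f) (ContinuousLinearMap.lsmul ℝ ℝ)
      volume s = causalConv κ f s := by
  rw [convolution, causalConv, intervalIntegral.integral_of_le hs, integral_Ioc_eq_integral_Ioo,
    ← integral_indicator measurableSet_Ioo]
  congr 1 with x
  simp only [ContinuousLinearMap.lsmul_apply, indicator, mem_Ioc, mem_Ioo]
  grind [zero_smul, smul_zero]

theorem convolutionExistsAt_mul_of_norm_le {a b : ℝ → ℝ} {M : ℝ} (ha : Integrable a)
    (hb : AEStronglyMeasurable b) (hbM : ∀ x, ‖b x‖ ≤ M) (t : ℝ) :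
    ConvolutionExistsAt a b t (ContinuousLinearMap.mul ℝ ℝ) volume :=
  ha.mul_bdd (hb.comp_quasiMeasurePreserving (quasiMeasurePreserving_sub_left volume t))
    (Eventually.of_forall fun _ => hbM _)

theorem norm_convolution_mul_le {a b : ℝ → ℝ} {M : ℝ} (ha : Integrable a) (hbM : ∀ x, ‖b x‖ ≤ M)
    (t : ℝ) :
    ‖convolution a b (ContinuousLinearMap.mul ℝ ℝ) volume t‖ ≤ (∫ y, ‖a y‖) * M := by
  rw [convolution, ← integral_mul_const]
  refine norm_integral_le_of_norm_le (ha.norm.mul_const M) (Eventually.of_forall fun y => ?_)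
  rw [ContinuousLinearMap.mul_apply', norm_mul]
  exact mul_le_mul_of_nonneg_left (hbM _) (norm_nonneg _)

theorem causalConv_congr {κ₁ κ₂ : ℝ → ℝ} (ht : 0 ≤ t) (h : EqOn κ₁ κ₂ (Ioc 0 t)) (f : ℝ → E) :
    causalConv κ₁ f t = causalConv κ₂ f t := by
  refine intervalIntegral.integral_congr_ae (Eventually.of_forall fun ξ hξ => ?_)
  rw [uIoc_of_le ht] at hξ
  rw [h hξ]

theorem continuous_integral_smul_comp_sub (hT : 0 ≤ T) (hκ : IntervalIntegrable κ volume 0 T)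
    (hf : Continuous f) {M : ℝ} (hM : ∀ s, ‖f s‖ ≤ M) :
    Continuous fun t => ∫ ξ in (0 : ℝ)..T, κ ξ • f (t - ξ) := by
  refine intervalIntegral.continuous_of_dominated_interval (bound := fun ξ => ‖κ ξ‖ * M)
    (fun t => ?_) (fun t => Eventually.of_forall fun ξ _ => ?_) (hκ.norm.mul_const _)
    (Eventually.of_forall fun ξ _ => by fun_prop)
  · rw [uIoc_of_le hT]
    exact (intervalIntegrable_smul_comp_sub hκ hf).1.aestronglyMeasurable
  · rw [norm_smul]
    exact mul_le_mul_of_nonneg_left (hM _) (norm_nonneg _)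

variable [CompleteSpace E]

theorem causalConv_causalConv {κ₁ κ₂ : ℝ → ℝ} (ht : 0 ≤ t)
    (h₁ : IntervalIntegrable κ₁ volume 0 t) (h₂ : IntervalIntegrable κ₂ volume 0 t)
    (hf : Continuous f) :
    causalConv κ₁ (causalConv κ₂ f) t = causalConv (causalConv κ₁ κ₂) f t := by
  set a := indicator (Ioc 0 t) κ₁
  set b := indicator (Ioc 0 t) κ₂ with hb
  set g := indicator (Ioc 0 t) f with hg
  have ha_int : Integrable a := integrable_indicator_Ioc ht h₁
  have hb_int : Integrable b := integrable_indicator_Ioc ht h₂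
  have hg_int : Integrable g := integrable_indicator_Ioc ht (hf.intervalIntegrable 0 t)
  obtain ⟨M, hM⟩ := isCompact_Icc.exists_bound_of_continuousOn (s := Icc 0 t) hf.continuousOn
  have hgM (x : ℝ) : ‖‖g x‖‖ ≤ M := by
    rw [norm_norm]
    by_cases hx : x ∈ Ioc 0 t
    · simpa [hg, hx] using hM x (Ioc_subset_Icc_self hx)
    · simpa [hg, hx] using (norm_nonneg _).trans (hM 0 ⟨le_rfl, ht⟩)
  have hassoc := convolution_assoc (μ := volume) (ν := volume) (f := a) (g := b) (k := g) (x₀ := t)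
    (ContinuousLinearMap.lsmul ℝ ℝ) (ContinuousLinearMap.lsmul ℝ ℝ)
    (ContinuousLinearMap.lsmul ℝ ℝ) (ContinuousLinearMap.lsmul ℝ ℝ)
    (fun x y z => by simp only [ContinuousLinearMap.lsmul_apply, smul_eq_mul, mul_smul])
    ha_int.aestronglyMeasurable hb_int.aestronglyMeasurable hg_int.aestronglyMeasurable
    (ha_int.ae_convolution_exists _ hb_int) (hb_int.norm.ae_convolution_exists _ hg_int.norm)
    (convolutionExistsAt_mul_of_norm_le ha_int.norm
      (hb_int.norm.integrable_convolution _ hg_int.norm).aestronglyMeasurable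
      (norm_convolution_mul_le hb_int.norm hgM) t)
  rw [convolution_indicator_right _ f ht, convolution_indicator_left κ₁ _ ht] at hassoc
  calc causalConv κ₁ (causalConv κ₂ f) t
      = causalConv κ₁ (convolution b g (ContinuousLinearMap.lsmul ℝ ℝ) volume) t := by
        simp only [← integral_comp_sub_smul κ₁]
        refine intervalIntegral.integral_congr fun s hs => ?_
        rw [uIcc_of_le ht] at hs
        simp only [hb, hg, convolution_indicator_indicator κ₂ f hs.1 hs.2]
    _ = causalConv (convolution a b (ContinuousLinearMap.lsmul ℝ ℝ) volume) f t := hassoc.symm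
    _ = causalConv (causalConv κ₁ κ₂) f t :=
        causalConv_congr ht (fun s hs => convolution_indicator_indicator κ₁ κ₂ hs.1.le hs.2) f

theorem causalConv_eq_integral_add {g : ℝ → E} (hκ : IntervalIntegrable κ volume 0 T)
    (hg : Continuous g) (hg₀ : ∀ s ≤ 0, g s = 0) (hfg : ∀ s ∈ Icc 0 T, f s = g s + f 0)
    (ht : t ∈ Icc 0 T) :
    causalConv κ f t
      = (∫ ξ in (0 : ℝ)..T, κ ξ • g (t - ξ)) + (∫ ξ in (0 : ℝ)..t, κ ξ) • f 0 := by
  have hint := intervalIntegrable_smul_comp_sub (s := t) hκ hg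
  have hint_t := intervalIntegrable_zero_of_le hint ht
  have htail : ∫ ξ in t..T, κ ξ • g (t - ξ) = 0 := by
    refine intervalIntegral.integral_zero_ae (Eventually.of_forall fun ξ hξ => ?_)
    rw [uIoc_of_le ht.2] at hξ
    rw [hg₀ _ (sub_nonpos.2 hξ.1.le), smul_zero]
  rw [← intervalIntegral.integral_add_adjacent_intervals hint_t (hint_t.symm.trans hint), htail,
    add_zero, ← intervalIntegral.integral_smul_const, ← intervalIntegral.integral_add hint_t
      ((intervalIntegrable_zero_of_le hκ ht).smul_continuousOn continuousOn_const)]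
  refine intervalIntegral.integral_congr fun ξ hξ => ?_
  rw [uIcc_of_le ht.1] at hξ
  simp only [← smul_add]
  rw [hfg _ ⟨by linarith [hξ.2], by linarith [hξ.1, ht.2]⟩]

theorem continuousOn_causalConv (hT : 0 ≤ T) (hκ : IntervalIntegrable κ volume 0 T)
    (hf : Continuous f) : ContinuousOn (causalConv κ f) (Icc 0 T) := by
  set g : ℝ → E := fun s => f (projIcc 0 T hT s) - f 0 with hg
  have hg_cont : Continuous g := by fun_prop
  have hg_zero : ∀ s ≤ 0, g s = 0 := fun s hs => by simp [hg, projIcc_of_le_left hT hs]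
  obtain ⟨M, hM⟩ := isCompact_Icc.exists_bound_of_continuousOn (s := Icc 0 T)
    (hf.sub continuous_const : Continuous fun s => f s - f 0).continuousOn
  have hprim : ContinuousOn (fun t => ∫ ξ in (0 : ℝ)..t, κ ξ) (Icc 0 T) := by
    simpa only [uIcc_of_le hT] using
      intervalIntegral.continuousOn_primitive_interval' hκ left_mem_uIcc
  refine ((continuous_integral_smul_comp_sub hT hκ hg_cont
    fun s => hM _ (projIcc 0 T hT s).2).continuousOn.add
    (hprim.smul (continuousOn_const (c := f 0)))).congr fun t ht => ?_
  exact causalConv_eq_integral_add hκ hg_cont hg_zero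
    (fun s hs => by simp [hg, projIcc_of_mem hT hs]) ht

end CausalConv

section Duhamel

variable {E : Type*} [NormedAddCommGroup E] [NormedSpace ℝ E] [CompleteSpace E]
  {ρ : ℝ} (hρ : 0 < ρ) (Λ : ℝ) {f : ℝ → E} (hf : Continuous f) {t : ℝ} (ht : 0 < t)

include hρ hf ht

theorem causalConv_rlKernel_causalConv_mlKernel (hρ₁ : ρ < 1) :
    causalConv (rlKernel (1 - ρ)) (causalConv (mlKernel ρ Λ) f) t
      = causalConv (mlRelax ρ Λ) f t := by
  rw [causalConv_causalConv ht.le (intervalIntegrable_rlKernel (sub_pos.2 hρ₁) t)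
    (intervalIntegrable_mlKernel hρ Λ ht) hf]
  refine causalConv_congr ht.le (fun ξ hξ => ?_) f
  rw [← integral_comp_sub_smul]
  exact integral_rlKernel_mul_mlKernel hρ Λ hξ.1 hρ₁

theorem continuousOn_causalConv_mlKernel :
    ContinuousOn (causalConv (mlKernel ρ Λ) f) (Icc 0 t) :=
  continuousOn_causalConv ht.le (intervalIntegrable_mlKernel hρ Λ ht) hf

theorem causalConv_mlRelax :
    causalConv (mlRelax ρ Λ) f t
      = ∫ s in (0 : ℝ)..t, (f s - Λ • causalConv (mlKernel ρ Λ) f s) := by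
  have he := intervalIntegrable_mlKernel hρ Λ ht
  have he_prim : IntervalIntegrable (causalConv (fun _ => 1) (mlKernel ρ Λ)) volume 0 t := by
    refine ContinuousOn.intervalIntegrable ?_
    rw [funext (causalConv_one (mlKernel ρ Λ))]
    exact intervalIntegral.continuousOn_primitive_interval' he left_mem_uIcc
  have hef : IntervalIntegrable (causalConv (mlKernel ρ Λ) f) volume 0 t :=
    ContinuousOn.intervalIntegrable
      (by simpa only [uIcc_of_le ht.le] using continuousOn_causalConv_mlKernel hρ Λ hf ht)
  calc causalConv (mlRelax ρ Λ) f t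
      = causalConv (fun ξ => 1 - Λ * causalConv (fun _ => 1) (mlKernel ρ Λ) ξ) f t :=
        causalConv_congr ht.le (fun ξ hξ => by
          rw [causalConv_one, mlRelax_eq_one_sub_integral hρ Λ hξ.1]) f
    _ = causalConv (fun _ => 1) f t
          - Λ • causalConv (causalConv (fun _ => 1) (mlKernel ρ Λ)) f t := by
        simp only [causalConv.eq_def _ f, sub_smul, mul_smul, ← intervalIntegral.integral_smul]
        exact intervalIntegral.integral_sub
          (intervalIntegrable_smul_comp_sub intervalIntegrable_const hf)
          ((intervalIntegrable_smul_comp_sub he_prim hf).smul Λ)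
    _ = (∫ s in (0 : ℝ)..t, f s) - Λ • ∫ s in (0 : ℝ)..t, causalConv (mlKernel ρ Λ) f s := by
        rw [← causalConv_causalConv ht.le intervalIntegrable_const he hf, causalConv_one,
          causalConv_one]
    _ = ∫ s in (0 : ℝ)..t, (f s - Λ • causalConv (mlKernel ρ Λ) f s) := by
        rw [← intervalIntegral.integral_smul]
        exact (intervalIntegral.integral_sub (hf.intervalIntegrable 0 t) (hef.smul Λ)).symm

theorem hasDerivAt_causalConv_mlRelax :
    HasDerivAt (causalConv (mlRelax ρ Λ) f) (f t - Λ • causalConv (mlKernel ρ Λ) f t) t := by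
  have hc : ContinuousOn (fun s => f s - Λ • causalConv (mlKernel ρ Λ) f s) (Icc 0 (t + 1)) :=
    hf.continuousOn.sub
      ((continuousOn_causalConv_mlKernel hρ Λ hf (by positivity)).const_smul Λ)
  have hint : IntervalIntegrable (fun s => f s - Λ • causalConv (mlKernel ρ Λ) f s) volume 0 t :=
    ContinuousOn.intervalIntegrable (hc.mono (by
      rw [uIcc_of_le ht.le]
      exact Icc_subset_Icc_right (by linarith)))
  have hmeas := (hc.mono Ioo_subset_Icc_self).stronglyMeasurableAtFilter (μ := volume) isOpen_Ioo t
    ⟨ht, lt_add_one t⟩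
  refine (intervalIntegral.integral_hasDerivAt_right hint hmeas
    (hc.continuousAt (Icc_mem_nhds ht (lt_add_one t)))).congr_of_eventuallyEq ?_
  filter_upwards [Ioi_mem_nhds ht] with s hs
  exact causalConv_mlRelax hρ Λ hf hs

end Duhamel

/-! ### The scalar fractional relaxation equation -/

section Mode

variable {E : Type*} [NormedAddCommGroup E] [NormedSpace ℝ E]

/-- The function `e(t) c + ∫_0^t e(ξ) f(t - ξ) dξ`, `e = mlKernel ρ Λ`, which solves the relaxation
equation `∂_t^ρ y + Λ y = f`, `∂_t^{ρ-1} y(0) = c`. -/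
def mode (ρ Λ : ℝ) (c : E) (f : ℝ → E) (t : ℝ) : E :=
  mlKernel ρ Λ t • c + causalConv (mlKernel ρ Λ) f t

/-- The fractional integral `∂_t^{ρ-1}` of `mode ρ Λ c f`. -/
def modeInt (ρ Λ : ℝ) (c : E) (f : ℝ → E) (t : ℝ) : E :=
  mlRelax ρ Λ t • c + causalConv (mlRelax ρ Λ) f t

theorem mode_one (Λ : ℝ) (c : E) (f : ℝ → E) : mode 1 Λ c f = modeInt 1 Λ c f := by
  ext t
  rw [mode, modeInt, mlKernel_one]

variable {ρ : ℝ} (hρ : 0 < ρ) (Λ : ℝ) (c : E) {f : ℝ → E}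

include hρ

theorem modeInt_zero : modeInt ρ Λ c f 0 = c := by
  simp [modeInt, mlRelax_zero hρ, causalConv]

theorem norm_mode_le (hρ₁ : ρ ≤ 1) {Λ : ℝ} (hΛ : 0 ≤ Λ) {t : ℝ} (ht : 0 < t) :
    ‖mode ρ Λ c f t‖ ≤ mode ρ Λ ‖c‖ (fun s => ‖f s‖) t := by
  refine (norm_add_le _ _).trans (add_le_add ?_
    (norm_causalConv_le_of_nonneg f (fun ξ hξ => (mlKernel_pos hρ hρ₁ hΛ hξ.1).le) ht.le))
  rw [norm_smul, Real.norm_of_nonneg (mlKernel_pos hρ hρ₁ hΛ ht).le, smul_eq_mul]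

theorem modeInt_le_add_integral (hρ₁ : ρ ≤ 1) {Λ : ℝ} (hΛ : 0 ≤ Λ) {c : ℝ} (hc : 0 ≤ c)
    {f : ℝ → ℝ} (hf : Continuous f) (hf₀ : ∀ s, 0 ≤ f s) {t : ℝ} (ht : 0 ≤ t) :
    modeInt ρ Λ c f t ≤ c + ∫ s in (0 : ℝ)..t, f s := by
  have hle {s : ℝ} (hs : 0 ≤ s) : mlRelax ρ Λ s ≤ 1 := mlRelax_le_one hρ hρ₁ hΛ hs
  rw [← causalConv_one]
  refine add_le_add (mul_le_of_le_one_left hc (hle ht)) ?_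
  refine intervalIntegral.integral_mono_on ht
    (intervalIntegrable_smul_comp_sub ((continuous_mlRelax hρ Λ).intervalIntegrable 0 t) hf)
    (intervalIntegrable_smul_comp_sub intervalIntegrable_const hf) fun ξ hξ => ?_
  exact mul_le_mul_of_nonneg_right (hle hξ.1) (hf₀ _)

variable [CompleteSpace E] (hf : Continuous f)

include hf

theorem continuousOn_modeInt {T : ℝ} (hT : 0 ≤ T) : ContinuousOn (modeInt ρ Λ c f) (Icc 0 T) :=
  ((continuous_mlRelax hρ Λ).smul continuous_const).continuousOn.add
    (continuousOn_causalConv hT ((continuous_mlRelax hρ Λ).intervalIntegrable 0 T) hf)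

theorem continuousOn_mode : ContinuousOn (mode ρ Λ c f) (Ioi 0) := fun t ht => by
  have hconv : ContinuousAt (causalConv (mlKernel ρ Λ) f) t :=
    (continuousOn_causalConv_mlKernel hρ Λ hf (add_pos ht one_pos)).continuousAt
      (Icc_mem_nhds ht (lt_add_one t))
  exact ((differentiableOn_mlKernel hρ Λ).continuousOn.smul continuousOn_const t ht).add
    hconv.continuousWithinAt

variable {t : ℝ} (ht : 0 < t)

include ht

theorem hasDerivAt_modeInt : HasDerivAt (modeInt ρ Λ c f) (f t - Λ • mode ρ Λ c f t) t := by
  refine (((hasDerivAt_mlRelax hρ Λ ht).smul_const c).add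
    (hasDerivAt_causalConv_mlRelax hρ Λ hf ht)).congr_deriv ?_
  rw [mode]
  module

theorem intervalIntegrable_rlKernel_smul_mode_and_integral_eq (hρ₁ : ρ < 1) :
    IntervalIntegrable (fun s => rlKernel (1 - ρ) (t - s) • mode ρ Λ c f s) volume 0 t ∧
      ∫ s in (0 : ℝ)..t, rlKernel (1 - ρ) (t - s) • mode ρ Λ c f s = modeInt ρ Λ c f t := by
  have hb : 0 < 1 - ρ := sub_pos.2 hρ₁
  have hexpand (s : ℝ) : rlKernel (1 - ρ) (t - s) • mode ρ Λ c f s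
      = (rlKernel (1 - ρ) (t - s) * mlKernel ρ Λ s) • c
        + rlKernel (1 - ρ) (t - s) • causalConv (mlKernel ρ Λ) f s := by
    rw [mode, smul_add, mul_smul]
  have hint_c := (intervalIntegrable_and_hasSum_integral_rlKernel_mul_mlKernel hρ Λ ht
    hb).1.smul_continuousOn (continuousOn_const (c := c))
  have hker : IntervalIntegrable (fun s => rlKernel (1 - ρ) (t - s)) volume 0 t := by
    simpa using ((intervalIntegrable_rlKernel hb t).comp_sub_left t).symm
  have hint_f := hker.smul_continuousOn (g := causalConv (mlKernel ρ Λ) f)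
    (by simpa only [uIcc_of_le ht.le] using continuousOn_causalConv_mlKernel hρ Λ hf ht)
  simp only [hexpand]
  refine ⟨hint_c.add hint_f, ?_⟩
  rw [intervalIntegral.integral_add hint_c hint_f, intervalIntegral.integral_smul_const,
    integral_rlKernel_mul_mlKernel hρ Λ ht hρ₁, integral_comp_sub_smul,
    causalConv_rlKernel_causalConv_mlKernel hρ Λ hf ht hρ₁, modeInt]

theorem integral_norm_rlKernel_smul_mode_le (hρ₁ : ρ < 1) {Λ : ℝ} (hΛ : 0 ≤ Λ) :
    ∫ s in (0 : ℝ)..t, ‖rlKernel (1 - ρ) (t - s) • mode ρ Λ c f s‖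
      ≤ ‖c‖ + ∫ s in (0 : ℝ)..t, ‖f s‖ := by
  obtain ⟨hint, hval⟩ :=
    intervalIntegrable_rlKernel_smul_mode_and_integral_eq hρ Λ ‖c‖ hf.norm ht hρ₁
  calc ∫ s in (0 : ℝ)..t, ‖rlKernel (1 - ρ) (t - s) • mode ρ Λ c f s‖
      ≤ ∫ s in (0 : ℝ)..t, rlKernel (1 - ρ) (t - s) • mode ρ Λ ‖c‖ (fun s => ‖f s‖) s := by
        refine intervalIntegral.integral_mono_on_of_le_Ioo ht.le
          (intervalIntegrable_rlKernel_smul_mode_and_integral_eq hρ Λ c hf ht hρ₁).1.norm hint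
          fun s hs => ?_
        have hk := rlKernel_nonneg (sub_pos.2 hρ₁) (sub_nonneg.2 hs.2.le)
        rw [norm_smul, Real.norm_of_nonneg hk]
        exact mul_le_mul_of_nonneg_left (norm_mode_le hρ c hρ₁.le hΛ hs.1) hk
    _ ≤ ‖c‖ + ∫ s in (0 : ℝ)..t, ‖f s‖ := by
        rw [hval]
        exact modeInt_le_add_integral hρ hρ₁.le hΛ (norm_nonneg c) hf.norm
          (fun s => norm_nonneg (f s)) ht.le

end Mode

/-! ### Uniformly summable families of functions -/

/-- The tails of `∑ ‖h n x‖` are small uniformly in `x ∈ K`. Unlike a summable bound for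
`sup_x ‖h n x‖`, this follows from norm-continuity of a curve in `ℓ¹`. -/
def UnifSummableOn {ι X E : Type*} [NormedAddCommGroup E] (h : ι → X → E) (K : Set X) : Prop :=
  ∀ ε > 0, ∃ S : Finset ι, ∀ T : Finset ι, Disjoint T S → ∀ x ∈ K, ∑ n ∈ T, ‖h n x‖ ≤ ε

namespace UnifSummableOn

variable {ι X Y E F : Type*} [NormedAddCommGroup E] [NormedAddCommGroup F]
  {h g : ι → X → E} {K : Set X}

theorem mono (hh : UnifSummableOn h K) {K' : Set X} (hK : K' ⊆ K) : UnifSummableOn h K' :=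
  fun ε hε => (hh ε hε).imp fun _ hS T hT x hx => hS T hT x (hK hx)

theorem comp {K' : Set Y} (hh : UnifSummableOn h K) {p : Y → X} (hp : MapsTo p K' K) :
    UnifSummableOn (fun n y => h n (p y)) K' :=
  fun ε hε => (hh ε hε).imp fun _ hS T hT y hy => hS T hT (p y) (hp hy)

theorem of_norm_le {q : ι → X → F} (hq : UnifSummableOn q K)
    (hle : ∀ n, ∀ x ∈ K, ‖h n x‖ ≤ ‖q n x‖) : UnifSummableOn h K :=
  fun ε hε => (hq ε hε).imp fun _ hS T hT x hx =>
    (Finset.sum_le_sum fun n _ => hle n x hx).trans (hS T hT x hx)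

theorem of_summable {a : ι → ℝ} (ha : Summable a) (hle : ∀ n, ∀ x ∈ K, ‖h n x‖ ≤ a n) :
    UnifSummableOn h K := by
  intro ε hε
  obtain ⟨S, hS⟩ := summable_iff_vanishing_norm.1 ha ε hε
  exact ⟨S, fun T hT x hx => (Finset.sum_le_sum fun n _ => hle n x hx).trans
    ((Real.le_norm_self _).trans (hS T hT).le)⟩

theorem add (hh : UnifSummableOn h K) (hg : UnifSummableOn g K) :
    UnifSummableOn (fun n x => h n x + g n x) K := by
  classical
  intro ε hε
  obtain ⟨S, hS⟩ := hh (ε / 2) (half_pos hε)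
  obtain ⟨S', hS'⟩ := hg (ε / 2) (half_pos hε)
  refine ⟨S ∪ S', fun T hT x hx => ?_⟩
  rw [Finset.disjoint_union_right] at hT
  calc ∑ n ∈ T, ‖h n x + g n x‖ ≤ ∑ n ∈ T, (‖h n x‖ + ‖g n x‖) :=
        Finset.sum_le_sum fun n _ => norm_add_le _ _
    _ ≤ ε := by
        rw [Finset.sum_add_distrib]
        linarith [hS T hT.1 x hx, hS' T hT.2 x hx]

theorem summable (hh : UnifSummableOn h K) {x : X} (hx : x ∈ K) : Summable fun n => ‖h n x‖ := by
  refine summable_iff_vanishing_norm.2 fun ε hε => ?_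
  obtain ⟨S, hS⟩ := hh (ε / 2) (half_pos hε)
  refine ⟨S, fun T hT => ?_⟩
  rw [Real.norm_of_nonneg (Finset.sum_nonneg fun _ _ => norm_nonneg _)]
  exact (hS T hT x hx).trans_lt (half_lt_self hε)

variable [CompleteSpace E]

theorem tendstoUniformlyOn (hh : UnifSummableOn h K) :
    TendstoUniformlyOn (fun (S : Finset ι) x => ∑ n ∈ S, h n x) (fun x => ∑' n, h n x) atTop K := by
  classical
  rw [Metric.tendstoUniformlyOn_iff]
  intro ε hε
  obtain ⟨S, hS⟩ := hh (ε / 2) (half_pos hε)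
  filter_upwards [eventually_ge_atTop S] with T hT x hx
  have hlim : Tendsto (fun U : Finset ι => dist (∑ n ∈ U, h n x) (∑ n ∈ T, h n x)) atTop
      (𝓝 (dist (∑' n, h n x) (∑ n ∈ T, h n x))) :=
    (Summable.of_norm (hh.summable hx)).hasSum.dist tendsto_const_nhds
  refine (le_of_tendsto hlim ?_).trans_lt (half_lt_self hε)
  filter_upwards [eventually_ge_atTop T] with U hU
  rw [dist_eq_norm, ← Finset.sum_sdiff hU, add_sub_cancel_right]
  exact (norm_sum_le _ _).trans
    (hS _ (Finset.disjoint_of_subset_right hT Finset.sdiff_disjoint) x hx)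

theorem continuousOn_tsum [TopologicalSpace X] (hh : UnifSummableOn h K)
    (hc : ∀ n, ContinuousOn (h n) K) : ContinuousOn (fun x => ∑' n, h n x) K :=
  hh.tendstoUniformlyOn.continuousOn
    (Frequently.of_forall fun S => continuousOn_finsetSum S fun n _ => hc n)

end UnifSummableOn

section DominatedKernels

variable {ι E F : Type*} [NormedAddCommGroup E] [NormedSpace ℝ E] [NormedAddCommGroup F]
  {κ : ι → ℝ → ℝ} {f : ι → ℝ → E} {q : ι → ℝ → F} {w : ℝ → ℝ} {T : ℝ}

theorem sum_norm_causalConv_le (U : Finset ι) (hT : 0 ≤ T) (hw : IntervalIntegrable w volume 0 T)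
    (hw₀ : ∀ ξ ∈ Ioc 0 T, 0 ≤ w ξ) (hκ : ∀ n, IntervalIntegrable (κ n) volume 0 T)
    (hf : ∀ n, Continuous (f n))
    (hle : ∀ n, ∀ ξ ∈ Ioc 0 T, ∀ s, |κ n ξ| * ‖f n s‖ ≤ w ξ * ‖q n s‖) {δ : ℝ}
    (hδ : ∀ s, ∑ n ∈ U, ‖q n s‖ ≤ δ) :
    ∑ n ∈ U, ‖causalConv (κ n) (f n) T‖ ≤ (∫ ξ in (0 : ℝ)..T, w ξ) * δ := by
  have hint (n : ι) : IntervalIntegrable (fun ξ => |κ n ξ| * ‖f n (T - ξ)‖) volume 0 T := by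
    simpa [norm_smul] using (intervalIntegrable_smul_comp_sub (s := T) (hκ n) (hf n)).norm
  calc ∑ n ∈ U, ‖causalConv (κ n) (f n) T‖
      ≤ ∑ n ∈ U, ∫ ξ in (0 : ℝ)..T, |κ n ξ| * ‖f n (T - ξ)‖ :=
        Finset.sum_le_sum fun n _ => norm_causalConv_le (κ n) (f n) hT
    _ = ∫ ξ in (0 : ℝ)..T, ∑ n ∈ U, |κ n ξ| * ‖f n (T - ξ)‖ :=
        (intervalIntegral.integral_finsetSum fun n _ => hint n).symm
    _ ≤ ∫ ξ in (0 : ℝ)..T, w ξ * δ := by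
        refine intervalIntegral.integral_mono_on_of_le_Ioo hT
          (by simpa only [Finset.sum_fn] using IntervalIntegrable.sum U fun n _ => hint n)
          (hw.mul_const δ) fun ξ hξ => ?_
        have hξ' := Ioo_subset_Ioc_self hξ
        calc ∑ n ∈ U, |κ n ξ| * ‖f n (T - ξ)‖ ≤ ∑ n ∈ U, w ξ * ‖q n (T - ξ)‖ :=
              Finset.sum_le_sum fun n _ => hle n ξ hξ' _
          _ ≤ w ξ * δ := by
              rw [← Finset.mul_sum]
              exact mul_le_mul_of_nonneg_left (hδ _) (hw₀ ξ hξ')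
    _ = (∫ ξ in (0 : ℝ)..T, w ξ) * δ := intervalIntegral.integral_mul_const _ _

theorem UnifSummableOn.causalConv_of_le (hq : UnifSummableOn q univ) (hT : 0 ≤ T)
    (hw : IntervalIntegrable w volume 0 T) (hw₀ : ∀ ξ ∈ Ioc 0 T, 0 ≤ w ξ)
    (hκ : ∀ n, IntervalIntegrable (κ n) volume 0 T) (hf : ∀ n, Continuous (f n))
    (hle : ∀ n, ∀ ξ ∈ Ioc 0 T, ∀ s, |κ n ξ| * ‖f n s‖ ≤ w ξ * ‖q n s‖) :
    UnifSummableOn (fun n => causalConv (κ n) (f n)) (Icc 0 T) := by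
  intro ε hε
  set I := ∫ ξ in (0 : ℝ)..T, w ξ
  have hI : 0 ≤ I := intervalIntegral_nonneg_of_Ioc hT hw₀
  obtain ⟨S, hS⟩ := hq (ε / (I + 1)) (by positivity)
  refine ⟨S, fun U hU t ht => ?_⟩
  have hsub : Ioc 0 t ⊆ Ioc 0 T := Ioc_subset_Ioc_right ht.2
  have hIt : ∫ ξ in (0 : ℝ)..t, w ξ ≤ I :=
    intervalIntegral.integral_mono_interval le_rfl ht.1 ht.2
      ((ae_restrict_iff' measurableSet_Ioc).2 (Eventually.of_forall hw₀)) hw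
  calc ∑ n ∈ U, ‖causalConv (κ n) (f n) t‖ ≤ (∫ ξ in (0 : ℝ)..t, w ξ) * (ε / (I + 1)) :=
        sum_norm_causalConv_le U ht.1 (intervalIntegrable_zero_of_le hw ht)
          (fun ξ hξ => hw₀ ξ (hsub hξ)) (fun n => intervalIntegrable_zero_of_le (hκ n) ht) hf
          (fun n ξ hξ => hle n ξ (hsub hξ)) fun s => hS U hU s (mem_univ s)
    _ ≤ (I + 1) * (ε / (I + 1)) := by gcongr; linarith
    _ = ε := by field_simp

end DominatedKernels

/-! ### Series of modes -/

theorem mode_mul (ρ Λ : ℝ) (c : ℂ) (f : ℝ → ℂ) (z : ℂ) (t : ℝ) :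
    mode ρ Λ (c * z) (fun s => f s * z) t = mode ρ Λ c f t * z := by
  simp only [mode, causalConv, ← smul_mul_assoc, intervalIntegral.integral_mul_const, add_mul]

theorem modeInt_mul (ρ Λ : ℝ) (c : ℂ) (f : ℝ → ℂ) (z : ℂ) (t : ℝ) :
    modeInt ρ Λ (c * z) (fun s => f s * z) t = modeInt ρ Λ c f t * z := by
  simp only [modeInt, causalConv, ← smul_mul_assoc, intervalIntegral.integral_mul_const, add_mul]

theorem fracInt_eq_integral_rlKernel_smul {ρ : ℝ} (hρ₁ : ρ < 1) (g : ℝ → ℂ) (t : ℝ) :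
    fracInt (1 - ρ) g t = ∫ s in (0 : ℝ)..t, rlKernel (1 - ρ) (t - s) • g s := by
  rw [fracInt, if_neg (sub_pos.2 hρ₁).ne', ← intervalIntegral.integral_const_mul]
  congr 1 with s
  rw [rlKernel, Complex.real_smul]
  push_cast
  ring

section Series

variable {ι E : Type*} [NormedAddCommGroup E] [NormedSpace ℝ E] {ρ : ℝ} (hρ : 0 < ρ)
  (hρ₁ : ρ ≤ 1) {Λ : ι → ℝ} (hΛ : ∀ n, 0 ≤ Λ n) {c : ι → E} (hc : Summable fun n => ‖c n‖)
  {f : ι → ℝ → E} (hf : ∀ n, Continuous (f n)) (hs : UnifSummableOn f univ)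

include hρ hρ₁ hΛ

section InitialPart

include hc

theorem unifSummableOn_smul_mlKernel_smul {δ T : ℝ} (hδ : 0 < δ) :
    UnifSummableOn (fun n t => Λ n • mlKernel ρ (Λ n) t • c n) (Icc δ T) := by
  refine UnifSummableOn.of_summable (hc.mul_left δ⁻¹) fun n t ht => ?_
  have ht₀ : 0 < t := hδ.trans_le ht.1
  have hk := mlKernel_pos hρ hρ₁ (hΛ n) ht₀
  have hle : Λ n * mlKernel ρ (Λ n) t ≤ δ⁻¹ := by
    rw [← one_div, le_div_iff₀ hδ]
    calc Λ n * mlKernel ρ (Λ n) t * δ = Λ n * (δ * mlKernel ρ (Λ n) t) := by ring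
      _ ≤ Λ n * (t * mlKernel ρ (Λ n) t) := by
          have := hΛ n
          gcongr
          exact ht.1
      _ ≤ 1 := mul_mul_mlKernel_le_one hρ hρ₁ (hΛ n) ht₀
  rw [smul_smul, norm_smul, Real.norm_of_nonneg (mul_nonneg (hΛ n) hk.le)]
  exact mul_le_mul_of_nonneg_right hle (norm_nonneg _)

end InitialPart

include hf

theorem unifSummableOn_smul_causalConv_mlKernel {ε : ℝ} (hε : 0 < ε) (hε₁ : ε < 1)
    (hsε : UnifSummableOn (fun n s => Λ n ^ ε • f n s) univ) {T : ℝ} (hT : 0 < T) :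
    UnifSummableOn (fun n t => Λ n • causalConv (mlKernel ρ (Λ n)) (f n) t) (Icc 0 T) := by
  have := Real.Gamma_pos_of_pos hρ
  have hw : IntervalIntegrable (fun ξ => (Real.Gamma ρ)⁻¹ ^ ε * ξ ^ (ε * ρ - 1)) volume 0 T :=
    (intervalIntegral.intervalIntegrable_rpow' (by linarith [mul_pos hε hρ])).const_mul _
  have hconv : UnifSummableOn (fun n => causalConv (fun ξ => Λ n * mlKernel ρ (Λ n) ξ) (f n))
      (Icc 0 T) := by
    refine hsε.causalConv_of_le hT.le hw (fun ξ hξ => by have := hξ.1; positivity)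
      (fun n => (intervalIntegrable_mlKernel hρ (Λ n) hT).const_mul _) hf fun n ξ hξ s => ?_
    have hpow : Λ n = Λ n ^ (1 - ε) * Λ n ^ ε := by
      rw [← Real.rpow_add' (hΛ n) (by simp), sub_add_cancel, Real.rpow_one]
    have hΛε := Real.rpow_nonneg (hΛ n) ε
    rw [abs_of_nonneg (mul_nonneg (hΛ n) (mlKernel_pos hρ hρ₁ (hΛ n) hξ.1).le), norm_smul,
      Real.norm_of_nonneg hΛε, ← mul_assoc]
    refine mul_le_mul_of_nonneg_right ?_ (norm_nonneg _)
    calc Λ n * mlKernel ρ (Λ n) ξ = Λ n ^ (1 - ε) * mlKernel ρ (Λ n) ξ * Λ n ^ ε := by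
          nth_rewrite 1 [hpow]; ring
      _ ≤ _ := mul_le_mul_of_nonneg_right (rpow_mul_mlKernel_le hρ hρ₁ (hΛ n) hξ.1 hε hε₁) hΛε
  refine hconv.of_norm_le fun n t _ => le_of_eq ?_
  simp only [causalConv, mul_smul, intervalIntegral.integral_smul]

include hc

theorem unifSummableOn_smul_mode {ε : ℝ} (hε : 0 < ε) (hε₁ : ε < 1)
    (hsε : UnifSummableOn (fun n s => Λ n ^ ε • f n s) univ) {δ T : ℝ} (hδ : 0 < δ) (hT : 0 < T) :
    UnifSummableOn (fun n t => Λ n • mode ρ (Λ n) (c n) (f n) t) (Icc δ T) := by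
  simp only [mode, smul_add]
  exact (unifSummableOn_smul_mlKernel_smul hρ hρ₁ hΛ hc hδ).add
    ((unifSummableOn_smul_causalConv_mlKernel hρ hρ₁ hΛ hf hε hε₁ hsε hT).mono
      (Icc_subset_Icc_left hδ.le))

include hs

theorem unifSummableOn_modeInt {T : ℝ} (hT : 0 ≤ T) :
    UnifSummableOn (fun n t => modeInt ρ (Λ n) (c n) (f n) t) (Icc 0 T) := by
  refine UnifSummableOn.add (UnifSummableOn.of_summable hc fun n t ht => ?_)
    (hs.causalConv_of_le (w := fun _ => 1) hT intervalIntegrable_const (fun _ _ => zero_le_one)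
      (fun n => (continuous_mlRelax hρ (Λ n)).intervalIntegrable 0 T) hf fun n ξ hξ s => ?_)
  · rw [norm_smul]
    exact mul_le_of_le_one_left (norm_nonneg _) (norm_mlRelax_le_one hρ hρ₁ (hΛ n) ht.1)
  · exact mul_le_mul_of_nonneg_right (norm_mlRelax_le_one hρ hρ₁ (hΛ n) hξ.1.le) (norm_nonneg _)

theorem summable_norm_mode {t : ℝ} (ht : 0 < t) :
    Summable fun n => ‖mode ρ (Λ n) (c n) (f n) t‖ := by
  have hinit (n : ι) : ‖mlKernel ρ (Λ n) t • c n‖ ≤ rlKernel ρ t * ‖c n‖ := by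
    rw [norm_smul, Real.norm_of_nonneg (mlKernel_pos hρ hρ₁ (hΛ n) ht).le]
    exact mul_le_mul_of_nonneg_right (mlKernel_le_rlKernel hρ hρ₁ (hΛ n) ht) (norm_nonneg _)
  have hconv := hs.causalConv_of_le ht.le (intervalIntegrable_rlKernel hρ t)
    (fun ξ hξ => rlKernel_nonneg hρ hξ.1.le) (fun n => intervalIntegrable_mlKernel hρ (Λ n) ht) hf
    fun n ξ hξ s => by
      rw [abs_of_pos (mlKernel_pos hρ hρ₁ (hΛ n) hξ.1)]
      exact mul_le_mul_of_nonneg_right (mlKernel_le_rlKernel hρ hρ₁ (hΛ n) hξ.1) (norm_nonneg _)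
  exact Summable.of_nonneg_of_le (fun n => norm_nonneg _)
    (fun n => (norm_add_le _ _).trans (add_le_add_left (hinit n) _))
    ((hc.mul_left (rlKernel ρ t)).add (hconv.summable ⟨ht.le, le_rfl⟩))

variable [CompleteSpace E]

theorem hasDerivAt_tsum_modeInt {ε : ℝ} (hε : 0 < ε) (hε₁ : ε < 1)
    (hsε : UnifSummableOn (fun n s => Λ n ^ ε • f n s) univ) {t : ℝ} (ht : 0 < t) :
    HasDerivAt (fun t => ∑' n, modeInt ρ (Λ n) (c n) (f n) t)
      (∑' n, (f n t - Λ n • mode ρ (Λ n) (c n) (f n) t)) t := by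
  have hderiv : UnifSummableOn (fun n t => f n t - Λ n • mode ρ (Λ n) (c n) (f n) t)
      (Icc (t / 2) (t + 1)) := by
    simp only [sub_eq_add_neg]
    refine (hs.mono (subset_univ _)).add (UnifSummableOn.of_norm_le (unifSummableOn_smul_mode hρ hρ₁
      hΛ hc hf hε hε₁ hsε (half_pos ht) (add_pos ht one_pos)) fun n s _ => (norm_neg _).le)
  refine hasDerivAt_of_tendstoUniformlyOn (l := atTop) (s := Ioo (t / 2) (t + 1)) isOpen_Ioo
    (hderiv.tendstoUniformlyOn.mono Ioo_subset_Icc_self)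
    (Eventually.of_forall fun S s hs' => ?_) (fun s hs' => ?_) ⟨half_lt_self ht, lt_add_one t⟩
    (f := fun S t => ∑ n ∈ S, modeInt ρ (Λ n) (c n) (f n) t)
  · exact HasDerivAt.fun_sum fun n _ =>
      hasDerivAt_modeInt hρ (Λ n) (c n) (hf n) ((half_pos ht).trans hs'.1)
  · have hs₀ : 0 ≤ s := ((half_pos ht).trans hs'.1).le
    exact (Summable.of_norm
      ((unifSummableOn_modeInt hρ hρ₁ hΛ hc hf hs hs₀).summable ⟨hs₀, le_rfl⟩)).hasSum

variable [Countable ι]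

omit hρ₁ in
theorem intervalIntegrable_and_hasSum_integral_mode (hρ₁' : ρ < 1) {t : ℝ} (ht : 0 < t) :
    IntervalIntegrable
      (fun s => rlKernel (1 - ρ) (t - s) • ∑' n, mode ρ (Λ n) (c n) (f n) s) volume 0 t ∧
    HasSum (fun n => modeInt ρ (Λ n) (c n) (f n) t)
      (∫ s in (0 : ℝ)..t, rlKernel (1 - ρ) (t - s) • ∑' n, mode ρ (Λ n) (c n) (f n) s) := by
  have hterm (n : ι) :=
    intervalIntegrable_rlKernel_smul_mode_and_integral_eq hρ (Λ n) (c n) (hf n) ht hρ₁'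
  have hsum : Summable fun n => ∫ s in (0 : ℝ)..t, ‖f n s‖ := by
    have h := hs.causalConv_of_le (κ := fun _ _ => 1) (f := fun n s => ‖f n s‖) (w := fun _ => 1)
      ht.le intervalIntegrable_const (fun _ _ => zero_le_one) (fun _ => intervalIntegrable_const)
      (fun n => (hf n).norm) fun n ξ _ s => by simp
    simpa only [causalConv_one] using (h.summable ⟨ht.le, le_rfl⟩).of_norm
  simp only [← fun n => (hterm n).2]
  simp only [intervalIntegrable_iff_integrableOn_Ioc_of_le ht.le,
    intervalIntegral.integral_of_le ht.le]
  refine integrable_and_hasSum_integral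
    (fun n => (intervalIntegrable_iff_integrableOn_Ioc_of_le ht.le).1 (hterm n).1) ?_ ?_
  · refine Summable.of_nonneg_of_le (fun n => integral_nonneg fun s => norm_nonneg _) (fun n => ?_)
      (hc.add hsum)
    rw [← intervalIntegral.integral_of_le ht.le]
    exact integral_norm_rlKernel_smul_mode_le hρ (c n) (hf n) ht hρ₁' (hΛ n)
  · refine (ae_restrict_iff' measurableSet_Ioc).2 (Eventually.of_forall fun s hs' => ?_)
    exact (Summable.of_norm (summable_norm_mode hρ hρ₁'.le hΛ hc hf hs hs'.1)).hasSum.const_smul _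

end Series

theorem fracInt_tsum_mode {ι : Type*} [Countable ι] {ρ : ℝ} (hρ : 0 < ρ) (hρ₁ : ρ ≤ 1) {Λ : ι → ℝ}
    (hΛ : ∀ n, 0 ≤ Λ n) {c : ι → ℂ} (hc : Summable fun n => ‖c n‖) {f : ι → ℝ → ℂ}
    (hf : ∀ n, Continuous (f n)) (hs : UnifSummableOn f univ) {t : ℝ} (ht : 0 < t) :
    fracInt (1 - ρ) (fun s => ∑' n, mode ρ (Λ n) (c n) (f n) s) t
      = ∑' n, modeInt ρ (Λ n) (c n) (f n) t := by
  rcases hρ₁.lt_or_eq with h | rfl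
  · rw [fracInt_eq_integral_rlKernel_smul h]
    exact (intervalIntegrable_and_hasSum_integral_mode hρ hΛ hc hf hs h ht).2.tsum_eq.symm
  · rw [sub_self, fracInt, if_pos rfl]
    simp only [mode_one]

/-! ### Fourier series on the torus -/

section Exponentials

variable {N : ℕ} (n : Fin N → ℤ)

theorem continuous_expFun : Continuous (expFun n) := by
  unfold expFun; fun_prop

theorem norm_expFun (x : Fin N → ℝ) : ‖expFun n x‖ = 1 := by
  rw [expFun, mul_comm, Complex.norm_exp_ofReal_mul_I]

theorem conj_expFun (x : Fin N → ℝ) : (starRingEnd ℂ) (expFun n x) = expFun (-n) x := by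
  simp [expFun, ← Complex.exp_conj]

theorem expFun_add (k : Fin N → ℤ) (x : Fin N → ℝ) :
    expFun (n + k) x = expFun n x * expFun k x := by
  rw [expFun, expFun, expFun, ← Complex.exp_add, ← mul_add, ← Complex.ofReal_add,
    ← Finset.sum_add_distrib]
  simp only [Pi.add_apply, Int.cast_add, add_mul]

theorem isPeriodic_expFun : IsPeriodic (expFun n) := by
  intro j x
  rw [expFun, expFun]
  have h : Complex.I * ((∑ i, (n i : ℝ) * (x + Pi.single j (2 * Real.pi) : Fin N → ℝ) i : ℝ) : ℂ)
      = Complex.I * ((∑ i, (n i : ℝ) * x i : ℝ) : ℂ) + n j * (2 * Real.pi * Complex.I) := by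
    simp only [Pi.add_apply, mul_add, Finset.sum_add_distrib, Pi.single_apply, mul_ite, mul_zero,
      Finset.sum_ite_eq', Finset.mem_univ, if_true]
    push_cast
    ring
  rw [h, Complex.exp_add, Complex.exp_int_mul_two_pi_mul_I, mul_one]

theorem coeFn_expL2 : expL2 n =ᵐ[torusMeasure N] expFun n := (memLp_expFun n).coeFn_toLp

end Exponentials

section Uncover

/-- The Haar probability measure on the torus `(ℝ / ℤ)^N`, for which the exponentials are known to
form a Hilbert basis. -/
abbrev haarTorus (N : ℕ) : Measure (UnitAddTorus (Fin N)) :=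
  Measure.pi fun _ => AddCircle.haarAddCircle

/-- The parametrization of the cell `(-π, π]^N` by the torus `(ℝ / ℤ)^N`, inverse to
`x ↦ x / 2π`. -/
def uncover {N : ℕ} (y : UnitAddTorus (Fin N)) : Fin N → ℝ :=
  (2 * Real.pi) • (UnitAddTorus.measurableEquivPiIoc (fun _ => -1 / 2) y : Fin N → ℝ)

theorem measurePreserving_uncover (N : ℕ) :
    MeasurePreserving uncover (haarTorus N)
      (ENNReal.ofReal ((2 * Real.pi) ^ N)⁻¹ • torusMeasure N) := by
  have hpi := Real.two_pi_pos
  have hunit : MeasurePreserving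
      (fun y => (UnitAddTorus.measurableEquivPiIoc (fun _ => -1 / 2) y : Fin N → ℝ)) (haarTorus N)
      (volume.restrict {x | ∀ i, x i ∈ Ioc (-1 / 2 : ℝ) (-1 / 2 + 1)}) :=
    (measurePreserving_subtype_coe (MeasurableSet.univ_pi' fun _ => measurableSet_Ioc)).comp
      (UnitAddTorus.measurePreserving_equivPiIoc fun _ => -1 / 2)
  have hscale : MeasurePreserving (fun x : Fin N → ℝ => (2 * Real.pi) • x) volume
      (ENNReal.ofReal ((2 * Real.pi) ^ N)⁻¹ • volume) := by
    refine ⟨measurable_const_smul _, ?_⟩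
    rw [Measure.map_addHaar_smul _ hpi.ne', Module.finrank_fin_fun, abs_of_pos (by positivity)]
  have hcell : (fun x : Fin N → ℝ => (2 * Real.pi) • x) ⁻¹' cell N
      = {x | ∀ i, x i ∈ Ioc (-1 / 2 : ℝ) (-1 / 2 + 1)} := by
    ext x
    simp only [cell, mem_preimage, mem_univ_pi, Pi.smul_apply, smul_eq_mul, mem_Ioc, mem_ofPred_eq]
    refine forall_congr' fun i => and_congr ?_ ?_
    · constructor <;> intro h <;> nlinarith
    · constructor <;> intro h <;> nlinarith
  have hmeas : MeasurableSet (cell N) := MeasurableSet.univ_pi fun _ => measurableSet_Ioc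
  have hrestrict := hscale.restrict_preimage hmeas
  rw [hcell, Measure.restrict_smul] at hrestrict
  exact hrestrict.comp hunit

variable {N : ℕ}

theorem mFourier_eq_expFun_uncover (n : Fin N → ℤ) (y : UnitAddTorus (Fin N)) :
    UnitAddTorus.mFourier n y = expFun n (uncover y) := by
  set x := UnitAddTorus.measurableEquivPiIoc (fun _ => -1 / 2) y with hx
  have hy : y = fun j => ((x : Fin N → ℝ) j : UnitAddCircle) :=
    ((UnitAddTorus.measurableEquivPiIoc _).symm_apply_apply y).symm
  rw [uncover, ← hx, hy]
  simp only [UnitAddTorus.mFourier, ContinuousMap.coe_mk, fourier_coe_apply, expFun,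
    ← Complex.exp_sum, Complex.ofReal_sum, Finset.mul_sum, Pi.smul_apply, smul_eq_mul]
  congr 1
  refine Finset.sum_congr rfl fun j _ => ?_
  push_cast
  ring

theorem integral_comp_uncover {g : (Fin N → ℝ) → ℂ}
    (hg : AEStronglyMeasurable g (torusMeasure N)) :
    ∫ y, g (uncover y) ∂(haarTorus N)
      = (((2 * Real.pi) ^ N : ℝ) : ℂ)⁻¹ * ∫ x, g x ∂(torusMeasure N) := by
  have hmp := measurePreserving_uncover N
  rw [← integral_map hmp.measurable.aemeasurable (by
      rw [hmp.map_eq]; exact hg.smul_measure _), hmp.map_eq, integral_smul_measure,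
    ENNReal.toReal_ofReal (by positivity), Complex.real_smul, Complex.ofReal_inv]

theorem mFourierCoeff_comp_uncover (g : L2T N) (n : Fin N → ℤ) :
    UnitAddTorus.mFourierCoeff (fun y => g (uncover y)) n = coeff g n := by
  rw [coeff, ← integral_comp_uncover (g := fun x => g x * expFun (-n) x)
    ((Lp.aestronglyMeasurable g).mul (continuous_expFun _).aestronglyMeasurable)]
  refine integral_congr_ae (Eventually.of_forall fun y => ?_)
  simp only [mFourier_eq_expFun_uncover, smul_eq_mul, mul_comm]

theorem eq_zero_of_coeff_eq_zero {g : L2T N} (hg : ∀ n, coeff g n = 0) : g = 0 := by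
  have hmp := measurePreserving_uncover N
  have hmem : MemLp (fun y => g (uncover y)) 2 (haarTorus N) :=
    ((Lp.memLp g).smul_measure ENNReal.ofReal_ne_top).comp_measurePreserving hmp
  have hzero : hmem.toLp _ = 0 := by
    refine (LinearIsometryEquiv.map_eq_zero_iff UnitAddTorus.mFourierBasis.repr).1 ?_
    ext n
    rw [UnitAddTorus.mFourierBasis_repr]
    refine (integral_congr_ae ?_).trans ((mFourierCoeff_comp_uncover g n).trans (hg n))
    filter_upwards [hmem.coeFn_toLp] with y hy
    rw [hy]
  have hae : (fun y => g (uncover y)) =ᵐ[haarTorus N] 0 :=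
    hmem.coeFn_toLp.symm.trans (hzero ▸ Lp.coeFn_zero ℂ 2 (haarTorus N))
  have hae' : ∀ᵐ x ∂(haarTorus N).map uncover, g x = 0 :=
    (ae_map_iff hmp.measurable.aemeasurable
      ((Lp.stronglyMeasurable g).measurable (measurableSet_singleton 0))).2 hae
  rw [hmp.map_eq, Measure.ae_ennreal_smul_measure_iff
    (ENNReal.ofReal_pos.2 (by positivity)).ne'] at hae'
  exact (Lp.eq_zero_iff_ae_eq_zero).2 hae'

end Uncover

section HilbertBasis

variable {N : ℕ}

theorem integral_expFun (n : Fin N → ℤ) :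
    ∫ x, expFun n x ∂(torusMeasure N) = if n = 0 then (((2 * Real.pi) ^ N : ℝ) : ℂ) else 0 := by
  have hpi : (((2 * Real.pi) ^ N : ℝ) : ℂ) ≠ 0 := by
    exact_mod_cast (pow_pos Real.two_pi_pos N).ne'
  have horth := orthonormal_iff_ite.1 (UnitAddTorus.orthonormal_mFourier (d := Fin N)) 0 n
  rw [ContinuousMap.inner_toLp] at horth
  simp only [UnitAddTorus.mFourier_zero, ContinuousMap.one_apply, map_one, mul_one,
    mFourier_eq_expFun_uncover] at horth
  have hint := integral_comp_uncover (continuous_expFun n).aestronglyMeasurable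
  rw [eq_inv_mul_iff_mul_eq₀ hpi] at hint
  rw [← hint, show ∫ y, expFun n (uncover y) ∂(haarTorus N) = _ from horth]
  simp [eq_comm]

theorem inner_expL2 (n : Fin N → ℤ) (g : L2T N) :
    inner ℂ (expL2 n) g = ∫ x, g x * expFun (-n) x ∂(torusMeasure N) := by
  rw [L2.inner_def]
  refine integral_congr_ae ?_
  filter_upwards [coeFn_expL2 n] with x hx
  rw [hx, RCLike.inner_apply, conj_expFun]

theorem coeff_eq_inner (g : L2T N) (n : Fin N → ℤ) :
    coeff g n = (((2 * Real.pi) ^ N : ℝ) : ℂ)⁻¹ * inner ℂ (expL2 n) g := by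
  rw [coeff, inner_expL2]

theorem inner_expL2_expL2 (n k : Fin N → ℤ) :
    inner ℂ (expL2 n) (expL2 k) = if n = k then (((2 * Real.pi) ^ N : ℝ) : ℂ) else 0 := by
  have hmul : ∫ x, expL2 k x * expFun (-n) x ∂(torusMeasure N)
      = ∫ x, expFun (k - n) x ∂(torusMeasure N) := by
    refine integral_congr_ae ?_
    filter_upwards [coeFn_expL2 k] with x hx
    rw [hx, sub_eq_add_neg, expFun_add]
  rw [inner_expL2, hmul, integral_expFun]
  simp only [sub_eq_zero, eq_comm]

/-- The factor `(2π)^{-N/2}` normalizing the exponentials in `L_2(𝕋^N)`. -/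
def expNorm (N : ℕ) : ℝ := (Real.sqrt ((2 * Real.pi) ^ N))⁻¹

theorem expNorm_pos (N : ℕ) : 0 < expNorm N := by
  unfold expNorm; positivity

theorem expNorm_mul_self (N : ℕ) : expNorm N * expNorm N = ((2 * Real.pi) ^ N)⁻¹ := by
  rw [expNorm, ← mul_inv, Real.mul_self_sqrt (by positivity)]

theorem orthonormal_expL2 (N : ℕ) :
    Orthonormal ℂ fun n : Fin N → ℤ => (expNorm N : ℂ) • (expL2 n : L2T N) := by
  rw [orthonormal_iff_ite]
  intro n k
  rw [inner_smul_left, inner_smul_right, inner_expL2_expL2, Complex.conj_ofReal]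
  split_ifs
  · rw [← mul_assoc, ← Complex.ofReal_mul, expNorm_mul_self, ← Complex.ofReal_mul,
      inv_mul_cancel₀ (by positivity), Complex.ofReal_one]
  · simp

/-- The normalized exponentials `(2π)^{-N/2} e^{inx}` as a Hilbert basis of `L_2(𝕋^N)`. -/
def expBasis (N : ℕ) : HilbertBasis (Fin N → ℤ) ℂ (L2T N) :=
  HilbertBasis.mkOfOrthogonalEqBot (orthonormal_expL2 N) (by
    rw [Submodule.eq_bot_iff]
    intro g hg
    refine eq_zero_of_coeff_eq_zero fun n => ?_
    have h := (Submodule.mem_orthogonal _ g).1 hg _ (Submodule.subset_span ⟨n, rfl⟩)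
    rw [inner_smul_left, Complex.conj_ofReal, mul_eq_zero] at h
    rw [coeff_eq_inner, h.resolve_left (by exact_mod_cast (expNorm_pos N).ne'), mul_zero])

theorem expBasis_apply (n : Fin N → ℤ) : expBasis N n = (expNorm N : ℂ) • (expL2 n : L2T N) := by
  rw [expBasis, HilbertBasis.coe_mkOfOrthogonalEqBot]

theorem coeff_eq_expBasis_repr (g : L2T N) (n : Fin N → ℤ) :
    coeff g n = (expNorm N : ℂ) * (expBasis N).repr g n := by
  rw [HilbertBasis.repr_apply_apply, expBasis_apply, inner_smul_left, coeff_eq_inner,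
    Complex.conj_ofReal, ← mul_assoc, ← Complex.ofReal_mul, expNorm_mul_self, Complex.ofReal_inv]

theorem continuous_coeff (n : Fin N → ℤ) : Continuous fun g : L2T N => coeff g n := by
  simp only [coeff_eq_inner]
  fun_prop

theorem sum_sq_coeff_le (g : L2T N) (S : Finset (Fin N → ℤ)) :
    ∑ n ∈ S, ‖coeff g n‖ ^ 2 ≤ (expNorm N * ‖g‖) ^ 2 := by
  have hbessel := (expBasis N).orthonormal.sum_inner_products_le g (s := S)
  simp only [← HilbertBasis.repr_apply_apply] at hbessel
  simp only [coeff_eq_expBasis_repr, norm_mul, mul_pow, Complex.norm_real, Real.norm_eq_abs,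
    sq_abs, ← Finset.mul_sum]
  exact mul_le_mul_of_nonneg_left hbessel (sq_nonneg _)

theorem hasSum_coeff_smul_expL2 (g : L2T N) : HasSum (fun n => coeff g n • expL2 n) g := by
  refine ((expBasis N).hasSum_repr g).congr_fun fun n => ?_
  rw [expBasis_apply, smul_smul, coeff_eq_expBasis_repr, mul_comm]

theorem coeff_tsum_smul_expL2 {a : (Fin N → ℤ) → ℂ} (ha : Summable fun n => ‖a n‖ ^ 2)
    (n : Fin N → ℤ) : coeff (∑' k, a k • (expL2 k : L2T N)) n = a n := by
  have hne : (expNorm N : ℂ) ≠ 0 := by exact_mod_cast (expNorm_pos N).ne'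
  have hmem : Memℓp (fun k => (expNorm N : ℂ)⁻¹ * a k) 2 := by
    refine memℓp_gen ?_
    simp only [norm_mul, ENNReal.toReal_ofNat, Real.rpow_ofNat, mul_pow]
    exact ha.mul_left _
  have hsum : HasSum (fun k => a k • expL2 k) ((expBasis N).repr.symm ⟨_, hmem⟩) :=
    ((expBasis N).hasSum_repr_symm ⟨_, hmem⟩).congr_fun fun k => by
      rw [expBasis_apply, smul_smul, mul_right_comm, inv_mul_cancel₀ hne, one_mul]
  rw [hsum.tsum_eq, coeff_eq_expBasis_repr, LinearIsometryEquiv.apply_symm_apply]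
  exact mul_inv_cancel_left₀ hne (a n)

theorem norm_expL2 (n : Fin N → ℤ) : ‖(expL2 n : L2T N)‖ = (expNorm N)⁻¹ := by
  have h := (orthonormal_expL2 N).1 n
  rw [norm_smul, Complex.norm_real, Real.norm_of_nonneg (expNorm_pos N).le] at h
  exact eq_inv_of_mul_eq_one_right h

theorem ae_eq_tsum_coeff_mul_expFun (g : L2T N) (hg : Summable fun n => ‖coeff g n‖) :
    (fun x => ∑' n, coeff g n * expFun n x) =ᵐ[torusMeasure N] g := by
  have hsum : ∑' n, ‖coeff g n • (expL2 n : L2T N)‖ₑ ≠ ⊤ := by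
    refine tsum_enorm_ne_top_iff_summable_norm.2 ?_
    simp only [norm_smul, norm_expL2]
    exact hg.mul_right _
  have hg_sum := Lp.coeFn_tsum hsum
  rw [(hasSum_coeff_smul_expL2 g).tsum_eq] at hg_sum
  have hterm : ∀ᵐ x ∂(torusMeasure N), ∀ n, (coeff g n • (expL2 n : L2T N) : L2T N) x
      = coeff g n * expFun n x := by
    refine ae_all_iff.2 fun n => ?_
    filter_upwards [Lp.coeFn_smul (coeff g n) (expL2 n : L2T N), coeFn_expL2 n] with x hx hx'
    rw [hx, Pi.smul_apply, hx', smul_eq_mul]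
  filter_upwards [hg_sum, hterm] with x hx hx'
  rw [hx]
  simp only [hx']

end HilbertBasis

/-! ### Differentiation of trigonometric series -/

theorem sum_eq_of_mem_support {N m : ℕ} {A : MvPolynomial (Fin N) ℝ} (hA : A.IsHomogeneous m)
    {α : Fin N →₀ ℕ} (hα : α ∈ A.support) : ∑ j, α j = m := by
  rw [← hA (MvPolynomial.mem_support_iff.1 hα), ← Finsupp.degree_eq_sum,
    Finsupp.degree_eq_weight_one]
  rfl

section TrigSeries

/-- The trigonometric series `∑_n c_n e^{i n x}`. -/
def trigSeries {N : ℕ} (c : (Fin N → ℤ) → ℂ) (x : Fin N → ℝ) : ℂ := ∑' n, c n * expFun n x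

/-- The coefficients `c` decay so fast that `∑_n (1 + ‖n‖)^k |c_n|` converges. -/
def WeightSummable {N : ℕ} (k : ℕ) (c : (Fin N → ℤ) → ℂ) : Prop :=
  Summable fun n => (1 + ‖n‖) ^ k * ‖c n‖

variable {N : ℕ} {c : (Fin N → ℤ) → ℂ}

theorem WeightSummable.mono {k l : ℕ} (hc : WeightSummable l c) (hkl : k ≤ l) :
    WeightSummable k c :=
  Summable.of_nonneg_of_le (fun n => by positivity) (fun n => mul_le_mul_of_nonneg_right
    (pow_le_pow_right₀ (by linarith [norm_nonneg n]) hkl) (norm_nonneg _)) hc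

theorem WeightSummable.summable {k : ℕ} (hc : WeightSummable k c) : Summable fun n => ‖c n‖ := by
  simpa [WeightSummable] using hc.mono (Nat.zero_le k)

theorem WeightSummable.intCast_pow_mul {k l : ℕ} (hc : WeightSummable (k + l) c) (j : Fin N) :
    WeightSummable k fun n => (n j : ℂ) ^ l * c n := by
  refine Summable.of_nonneg_of_le (fun n => by positivity) (fun n => ?_) hc
  have hj : ‖(n j : ℂ)‖ ≤ 1 + ‖n‖ := by
    rw [Complex.norm_intCast, ← Int.norm_eq_abs]
    linarith [norm_le_pi_norm n j]
  rw [norm_mul, norm_pow, pow_add, mul_assoc]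
  gcongr

theorem summable_norm_mul_expFun (hc : Summable fun n => ‖c n‖) (x : Fin N → ℝ) :
    Summable fun n => ‖c n * expFun n x‖ := by
  simpa [norm_expFun] using hc

theorem isPeriodic_trigSeries (c : (Fin N → ℤ) → ℂ) : IsPeriodic (trigSeries c) := by
  intro j x
  simp only [trigSeries, isPeriodic_expFun _ j x]

theorem continuous_trigSeries (hc : Summable fun n => ‖c n‖) : Continuous (trigSeries c) :=
  continuous_tsum (fun n => continuous_const.mul (continuous_expFun n)) hc
    fun n x => by simp [norm_expFun]

/-- The `j`-th coordinate as a complex-valued real-linear map. -/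
def coordCLM (j : Fin N) : (Fin N → ℝ) →L[ℝ] ℂ :=
  Complex.ofRealCLM.comp (ContinuousLinearMap.proj j)

theorem hasFDerivAt_expFun (n : Fin N → ℤ) (x : Fin N → ℝ) :
    HasFDerivAt (expFun n) (∑ j, (Complex.I * n j * expFun n x) • coordCLM j) x := by
  have hlin : (fun y : Fin N → ℝ => Complex.I * ((∑ j, (n j : ℝ) * y j : ℝ) : ℂ))
      = (∑ j, (Complex.I * n j) • coordCLM j : (Fin N → ℝ) →L[ℝ] ℂ) := by
    ext y
    simp only [coordCLM, _root_.sum_apply, _root_.smul_apply, ContinuousLinearMap.comp_apply,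
      ContinuousLinearMap.proj_apply, Complex.ofRealCLM_apply, smul_eq_mul]
    push_cast
    rw [Finset.mul_sum]
    exact Finset.sum_congr rfl fun j _ => by ring
  have hphase : HasFDerivAt
      (fun y : Fin N → ℝ => Complex.I * ((∑ j, (n j : ℝ) * y j : ℝ) : ℂ))
      (∑ j, (Complex.I * n j) • coordCLM j) x := by
    rw [hlin]
    exact ContinuousLinearMap.hasFDerivAt _
  refine hphase.cexp.congr_fderiv ?_
  rw [Finset.smul_sum]
  refine Finset.sum_congr rfl fun j _ => ?_
  rw [smul_smul, expFun]
  congr 1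
  ring

theorem hasFDerivAt_trigSeries (hc : WeightSummable 1 c) (x : Fin N → ℝ) :
    HasFDerivAt (trigSeries c)
      (∑ j, (Complex.I * trigSeries (fun n => (n j : ℂ) * c n) x) • coordCLM j) x := by
  have hcj : ∀ j, Summable fun n : Fin N → ℤ => ‖(n j : ℂ) * c n‖ := fun j => by
    simpa only [pow_one] using (hc.intCast_pow_mul (k := 0) (l := 1) j).summable
  have hsum : ∀ j, Summable fun n : Fin N → ℤ => (n j : ℂ) * c n * expFun n x := fun j =>
    (summable_norm_mul_expFun (hcj j) x).of_norm
  have hderiv := hasFDerivAt_tsum (𝕜 := ℝ) (f := fun n x => c n * expFun n x)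
    (f' := fun n x => ∑ j, (Complex.I * ((n j : ℂ) * c n * expFun n x)) • coordCLM j)
    (u := fun n => ∑ j, ‖(n j : ℂ) * c n‖ * ‖coordCLM j‖) (x₀ := x)
    (summable_sum fun j _ => (hcj j).mul_right _) (fun n y => ?_) (fun n y => ?_)
    (summable_norm_mul_expFun hc.summable x).of_norm x
  · refine hderiv.congr_fderiv ?_
    rw [Summable.tsum_finsetSum fun j _ => ((hsum j).mul_left _).smul_const _]
    refine Finset.sum_congr rfl fun j _ => ?_
    rw [((hsum j).mul_left _).tsum_smul_const, tsum_mul_left]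
    rfl
  · refine ((hasFDerivAt_expFun n y).const_mul (c n)).congr_fderiv ?_
    rw [Finset.smul_sum]
    refine Finset.sum_congr rfl fun j _ => ?_
    rw [smul_smul]
    congr 1
    ring
  · refine (norm_sum_le _ _).trans (Finset.sum_le_sum fun j _ => ?_)
    rw [norm_smul, norm_mul, norm_mul _ (expFun n y), norm_expFun, Complex.norm_I, one_mul, mul_one]

theorem contDiff_trigSeries (k : ℕ) : ∀ {c : (Fin N → ℤ) → ℂ}, WeightSummable k c →
    ContDiff ℝ k (trigSeries c) := by
  induction k with
  | zero => exact fun hc => contDiff_zero.2 (continuous_trigSeries hc.summable)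
  | succ k ih =>
    intro c hc
    have hc1 : WeightSummable 1 c := hc.mono (by omega)
    have hfd : fderiv ℝ (trigSeries c)
        = fun x => ∑ j, (Complex.I * trigSeries (fun n => (n j : ℂ) * c n) x) • coordCLM j :=
      funext fun x => (hasFDerivAt_trigSeries hc1 x).fderiv
    push_cast
    rw [contDiff_succ_iff_fderiv]
    refine ⟨fun x => (hasFDerivAt_trigSeries hc1 x).differentiableAt, by simp, ?_⟩
    rw [hfd]
    refine ContDiff.sum fun j _ => ContDiff.smul (contDiff_const.mul (ih ?_)) contDiff_const
    simpa using hc.intCast_pow_mul j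

theorem partialD_trigSeries (hc : WeightSummable 1 c) (j : Fin N) :
    partialD j (trigSeries c) = trigSeries fun n => (n j : ℂ) * c n := by
  ext x
  rw [partialD, (hasFDerivAt_trigSeries hc x).fderiv, _root_.sum_apply,
    Finset.sum_eq_single j]
  · simp only [_root_.smul_apply, coordCLM, ContinuousLinearMap.comp_apply,
      ContinuousLinearMap.proj_apply, Pi.single_eq_same, Complex.ofRealCLM_apply, smul_eq_mul,
      Complex.ofReal_one, mul_one]
    rw [← mul_assoc, neg_mul, Complex.I_mul_I, neg_neg, one_mul]
  · intro i _ hi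
    simp [coordCLM, Pi.single_eq_of_ne hi]
  · simp

theorem iterate_partialD_trigSeries (j : Fin N) (k : ℕ) (hc : WeightSummable k c) :
    (partialD j)^[k] (trigSeries c) = trigSeries fun n => (n j : ℂ) ^ k * c n := by
  induction k with
  | zero => simp
  | succ k ih =>
    rw [Function.iterate_succ_apply', ih (hc.mono (Nat.le_succ k)), partialD_trigSeries]
    · congr 1 with n
      ring
    · exact WeightSummable.intCast_pow_mul (by rwa [add_comm]) j

theorem foldr_partialD_trigSeries (α : Fin N → ℕ) (l : List (Fin N)) :
    ∀ p, WeightSummable (p + (l.map α).sum) c →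
      WeightSummable p (fun n => (l.map fun j => (n j : ℂ) ^ α j).prod * c n) ∧
      l.foldr (fun j h => (partialD j)^[α j] h) (trigSeries c)
        = trigSeries fun n => (l.map fun j => (n j : ℂ) ^ α j).prod * c n := by
  induction l with
  | nil => intro p hc; simpa using hc
  | cons j l ih =>
    intro p hc
    rw [List.map_cons, List.sum_cons, ← add_assoc] at hc
    obtain ⟨hsum, hfold⟩ := ih (p + α j) hc
    have hcons : (fun n : Fin N → ℤ => ((j :: l).map fun j => (n j : ℂ) ^ α j).prod * c n)
        = fun n => (n j : ℂ) ^ α j * ((l.map fun j => (n j : ℂ) ^ α j).prod * c n) := by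
      ext n; rw [List.map_cons, List.prod_cons, mul_assoc]
    rw [hcons]
    refine ⟨hsum.intCast_pow_mul j, ?_⟩
    rw [List.foldr_cons, hfold, iterate_partialD_trigSeries j _ (hsum.mono (by omega))]

theorem multiD_trigSeries {α : Fin N →₀ ℕ} (hc : WeightSummable (∑ j, α j) c) :
    WeightSummable 0 (fun n => (∏ j, (n j : ℂ) ^ α j) * c n) ∧
    multiD α (trigSeries c) = trigSeries fun n => (∏ j, (n j : ℂ) ^ α j) * c n := by
  have h := foldr_partialD_trigSeries (c := c) α (List.finRange N) 0 (by
    rwa [zero_add, ← Fin.sum_univ_def])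
  simp only [← Fin.prod_univ_def] at h
  exact h

theorem diffOp_trigSeries {A : MvPolynomial (Fin N) ℝ} {m : ℕ} (hA : A.IsHomogeneous m)
    (hc : WeightSummable m c) (x : Fin N → ℝ) :
    diffOp A (trigSeries c) x = trigSeries (fun n => symbolAt A n • c n) x := by
  have hα : ∀ α ∈ A.support, WeightSummable (∑ j, α j) c := fun α h => by
    rwa [sum_eq_of_mem_support hA h]
  rw [diffOp, Finset.sum_congr rfl fun α h => by rw [(multiD_trigSeries (hα α h)).2]]
  simp only [trigSeries, ← tsum_mul_left]
  rw [← Summable.tsum_finsetSum]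
  · refine tsum_congr fun n => ?_
    rw [symbolAt, MvPolynomial.eval_eq', Complex.real_smul]
    push_cast
    rw [Finset.sum_mul, Finset.sum_mul]
    exact Finset.sum_congr rfl fun α _ => by ring
  · intro α h
    exact ((summable_norm_mul_expFun (multiD_trigSeries (hα α h)).1.summable x).of_norm).mul_left _

end TrigSeries

/-! ### Elliptic symbols and Sobolev coefficients -/

section Symbol

variable {N m : ℕ} {A : MvPolynomial (Fin N) ℝ}

theorem eval_smul_of_isHomogeneous (hA : A.IsHomogeneous m) (s : ℝ) (ξ : Fin N → ℝ) :
    MvPolynomial.eval (s • ξ) A = s ^ m * MvPolynomial.eval ξ A := by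
  rw [MvPolynomial.eval_eq', MvPolynomial.eval_eq', Finset.mul_sum]
  refine Finset.sum_congr rfl fun α hα => ?_
  simp only [Pi.smul_apply, smul_eq_mul, mul_pow, Finset.prod_mul_distrib]
  rw [Finset.prod_pow_eq_pow_sum, sum_eq_of_mem_support hA hα]
  ring

theorem eval_zero_of_isHomogeneous (hA : A.IsHomogeneous m) (hm : m ≠ 0) :
    MvPolynomial.eval 0 A = 0 := by
  simpa [hm] using eval_smul_of_isHomogeneous hA 0 0

theorem exists_bounds_eval_unitSphere (hA : IsEllipticSymbol A m) :
    ∃ a C : ℝ, 0 < a ∧ 0 < C ∧ ∀ ξ ∈ Metric.sphere (0 : Fin N → ℝ) 1,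
      a ≤ MvPolynomial.eval ξ A ∧ MvPolynomial.eval ξ A ≤ C := by
  have hcont : Continuous fun ξ : Fin N → ℝ => MvPolynomial.eval ξ A :=
    MvPolynomial.continuous_eval A
  have hcpt : IsCompact (Metric.sphere (0 : Fin N → ℝ) 1) := isCompact_sphere 0 1
  have hpos : ∀ ξ ∈ Metric.sphere (0 : Fin N → ℝ) 1, 0 < MvPolynomial.eval ξ A :=
    fun ξ hξ => hA.elliptic ξ (ne_zero_of_mem_unit_sphere ⟨ξ, hξ⟩)
  rcases (Metric.sphere (0 : Fin N → ℝ) 1).eq_empty_or_nonempty with hempty | hne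
  · exact ⟨1, 1, one_pos, one_pos, by simp [hempty]⟩
  · obtain ⟨ξ₁, h₁, hmin⟩ := hcpt.exists_isMinOn hne hcont.continuousOn
    obtain ⟨ξ₂, h₂, hmax⟩ := hcpt.exists_isMaxOn hne hcont.continuousOn
    exact ⟨_, _, hpos _ h₁, hpos _ h₂, fun ξ hξ => ⟨hmin hξ, hmax hξ⟩⟩

theorem exists_bounds_eval (hA : IsEllipticSymbol A m) :
    ∃ a C : ℝ, 0 < a ∧ 0 < C ∧ ∀ ξ, a * ‖ξ‖ ^ m ≤ MvPolynomial.eval ξ A ∧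
      MvPolynomial.eval ξ A ≤ C * ‖ξ‖ ^ m := by
  obtain ⟨a, C, ha, hC, h⟩ := exists_bounds_eval_unitSphere hA
  refine ⟨a, C, ha, hC, fun ξ => ?_⟩
  rcases eq_or_ne ξ 0 with rfl | hξ
  · rw [eval_zero_of_isHomogeneous hA.homogeneous hA.order_pos.ne']
    simp [hA.order_pos.ne']
  · have hn : 0 < ‖ξ‖ := norm_pos_iff.2 hξ
    obtain ⟨hlower, hupper⟩ := h (‖ξ‖⁻¹ • ξ) (by simp [norm_smul, hn.ne'])
    have hscale : MvPolynomial.eval ξ A = ‖ξ‖ ^ m * MvPolynomial.eval (‖ξ‖⁻¹ • ξ) A := by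
      rw [← eval_smul_of_isHomogeneous hA.homogeneous, smul_smul, mul_inv_cancel₀ hn.ne', one_smul]
    rw [hscale, mul_comm a, mul_comm C]
    constructor <;> gcongr

theorem norm_intCast_pi (n : Fin N → ℤ) : ‖fun j => (n j : ℝ)‖ = ‖n‖ := by
  simp only [Pi.norm_def]
  congr 2

theorem exists_bounds_symbolAt (hA : IsEllipticSymbol A m) :
    ∃ a C : ℝ, 0 < a ∧ 0 < C ∧ ∀ n : Fin N → ℤ, a * ‖n‖ ^ m ≤ symbolAt A n ∧
      symbolAt A n ≤ C * ‖n‖ ^ m := by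
  obtain ⟨a, C, ha, hC, h⟩ := exists_bounds_eval hA
  refine ⟨a, C, ha, hC, fun n => ?_⟩
  have := h fun j => (n j : ℝ)
  rwa [norm_intCast_pi] at this

theorem symbolAt_nonneg (hA : IsEllipticSymbol A m) (n : Fin N → ℤ) : 0 ≤ symbolAt A n := by
  obtain ⟨a, _, ha, _, h⟩ := exists_bounds_symbolAt hA
  exact le_trans (by positivity) (h n).1

theorem symbolAt_pos (hA : IsEllipticSymbol A m) {n : Fin N → ℤ} (hn : n ≠ 0) :
    0 < symbolAt A n := by
  obtain ⟨a, _, ha, _, h⟩ := exists_bounds_symbolAt hA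
  have := norm_pos_iff.2 hn
  exact lt_of_lt_of_le (by positivity) (h n).1

theorem one_le_norm_of_ne_zero {n : Fin N → ℤ} (hn : n ≠ 0) : 1 ≤ ‖n‖ := by
  obtain ⟨j, hj⟩ := Function.ne_iff.1 hn
  refine le_trans ?_ (norm_le_pi_norm n j)
  rw [Int.norm_eq_abs]
  exact_mod_cast Int.one_le_abs hj

theorem weightSummable_of_summable_symbolAt_smul (hA : IsEllipticSymbol A m) {c : (Fin N → ℤ) → ℂ}
    (hc : Summable fun n => ‖symbolAt A n • c n‖) : WeightSummable m c := by
  obtain ⟨a, _, ha, _, h⟩ := exists_bounds_symbolAt hA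
  refine Summable.of_norm_bounded_eventually (hc.mul_left (2 ^ m * a⁻¹)) ?_
  filter_upwards [(finite_singleton (0 : Fin N → ℤ)).compl_mem_cofinite] with n hn
  have hn1 := one_le_norm_of_ne_zero hn
  rw [Real.norm_of_nonneg (by positivity), norm_smul, Real.norm_of_nonneg (symbolAt_nonneg hA n),
    ← mul_assoc]
  refine mul_le_mul_of_nonneg_right ?_ (norm_nonneg _)
  calc (1 + ‖n‖) ^ m ≤ (2 * ‖n‖) ^ m := by gcongr; linarith
    _ = 2 ^ m * a⁻¹ * (a * ‖n‖ ^ m) := by rw [mul_pow]; field_simp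
    _ ≤ 2 ^ m * a⁻¹ * symbolAt A n := by gcongr; exact (h n).1

theorem summable_norm_rpow_intLattice {r : ℝ} (hr : (N : ℝ) < r) :
    Summable fun n : Fin N → ℤ => ‖n‖ ^ (-r) := by
  set b := Pi.basisFun ℝ (Fin N)
  set L := Submodule.span ℤ (range b)
  have hrank : Module.finrank ℤ L = N := by
    rw [ZLattice.rank ℝ L, Module.finrank_fin_fun]
  have hmem (n : Fin N → ℤ) : (fun j => (n j : ℝ)) ∈ L := by
    have hn : (fun j => (n j : ℝ)) = ∑ j, n j • b j := by
      ext i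
      simp [b, Finset.sum_apply, Pi.single_apply]
    rw [hn]
    exact Submodule.sum_mem _ fun j _ => Submodule.smul_mem _ _ (Submodule.subset_span ⟨j, rfl⟩)
  have hinj : Function.Injective fun n : Fin N → ℤ => (⟨fun j => (n j : ℝ), hmem n⟩ : L) := by
    intro n k h
    ext j
    exact Int.cast_injective (congrFun (congrArg Subtype.val h) j)
  have hsum := (ZLattice.summable_norm_rpow L (-r) (by rw [hrank]; linarith)).comp_injective hinj
  refine hsum.congr fun n => ?_
  rw [Function.comp_apply, Submodule.coe_norm, norm_intCast_pi]

theorem summable_symbolAt_rpow_sq (hA : IsEllipticSymbol A m) {σ : ℝ}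
    (hσ : (N : ℝ) < 2 * (m * σ)) :
    Summable fun n : Fin N → ℤ => (symbolAt A n ^ (-σ)) ^ 2 := by
  obtain ⟨a, _, ha, _, h⟩ := exists_bounds_symbolAt hA
  have hσ₀ : 0 < σ :=
    pos_of_mul_pos_right (by linarith [N.cast_nonneg (α := ℝ)] : 0 < (m : ℝ) * σ) m.cast_nonneg
  refine Summable.of_norm_bounded_eventually
    ((summable_norm_rpow_intLattice hσ).mul_left ((a ^ (-σ)) ^ 2)) ?_
  filter_upwards [(finite_singleton (0 : Fin N → ℤ)).compl_mem_cofinite] with n hn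
  have hn₀ : 0 < ‖n‖ := norm_pos_iff.2 hn
  have hle : symbolAt A n ^ (-σ) ≤ a ^ (-σ) * ‖n‖ ^ (-(m * σ)) := by
    refine (Real.rpow_le_rpow_of_nonpos (by positivity) (h n).1 (by linarith)).trans_eq ?_
    rw [Real.mul_rpow ha.le (by positivity), ← Real.rpow_natCast_mul hn₀.le, mul_neg]
  rw [Real.norm_of_nonneg (by positivity)]
  calc (symbolAt A n ^ (-σ)) ^ 2 ≤ (a ^ (-σ) * ‖n‖ ^ (-(m * σ))) ^ 2 :=
        pow_le_pow_left₀ (Real.rpow_nonneg (symbolAt_nonneg hA n) _) hle 2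
    _ = (a ^ (-σ)) ^ 2 * ‖n‖ ^ (-(2 * (m * σ))) := by
        rw [mul_pow, ← Real.rpow_mul_natCast hn₀.le, Nat.cast_ofNat]
        ring_nf

theorem norm_sq_le_sum_sq (n : Fin N → ℤ) : ‖n‖ ^ 2 ≤ ∑ j, (n j : ℝ) ^ 2 := by
  have hle : ‖n‖ ≤ √(∑ j, (n j : ℝ) ^ 2) := by
    refine (pi_norm_le_iff_of_nonneg (Real.sqrt_nonneg _)).2 fun j => ?_
    rw [Int.norm_eq_abs]
    exact Real.abs_le_sqrt (Finset.single_le_sum (f := fun j => (n j : ℝ) ^ 2)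
      (fun i _ => sq_nonneg _) (Finset.mem_univ j))
  exact (Real.le_sqrt (norm_nonneg n) (Finset.sum_nonneg fun i _ => sq_nonneg _)).1 hle

theorem summable_norm_coeff {τ : ℝ} (hτ : (N : ℝ) / 2 < τ) {g : L2T N} (hg : MemSobolev τ g) :
    Summable fun n => ‖coeff g n‖ := by
  have hτ₀ : 0 < τ := lt_of_le_of_lt (by positivity) hτ
  have hweight : Summable fun n : Fin N → ℤ => (1 + ∑ j, (n j : ℝ) ^ 2) ^ (-τ) := by
    refine Summable.of_norm_bounded_eventually
      (summable_norm_rpow_intLattice (r := 2 * τ) (by linarith)) ?_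
    filter_upwards [(finite_singleton (0 : Fin N → ℤ)).compl_mem_cofinite] with n hn
    have hn₀ : 0 < ‖n‖ := norm_pos_iff.2 hn
    calc ‖(1 + ∑ j, (n j : ℝ) ^ 2) ^ (-τ)‖ = (1 + ∑ j, (n j : ℝ) ^ 2) ^ (-τ) :=
          Real.norm_of_nonneg (by positivity)
      _ ≤ (‖n‖ ^ 2) ^ (-τ) := Real.rpow_le_rpow_of_nonpos (by positivity)
          (by linarith [norm_sq_le_sum_sq n]) (by linarith)
      _ = ‖n‖ ^ (-(2 * τ)) := by
          rw [← Real.rpow_natCast_mul hn₀.le, mul_neg, Nat.cast_ofNat]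
  refine Summable.of_nonneg_of_le (fun n => norm_nonneg _) (fun n => ?_) (hweight.add hg)
  have hw : 0 < (1 + ∑ j, (n j : ℝ) ^ 2) ^ τ := by positivity
  rw [Real.rpow_neg (by positivity)]
  set w := (1 + ∑ j, (n j : ℝ) ^ 2) ^ τ
  have hsq : w⁻¹ + w * ‖coeff g n‖ ^ 2 - 2 * ‖coeff g n‖ = w⁻¹ * (1 - w * ‖coeff g n‖) ^ 2 := by
    field_simp
    ring
  have hsq₀ : 0 ≤ w⁻¹ * (1 - w * ‖coeff g n‖) ^ 2 := by positivity
  linarith [norm_nonneg (coeff g n)]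

theorem exists_symbolAt_rpow_sq_le (hA : IsEllipticSymbol A m) {τ : ℝ} (hτ : 0 ≤ τ) :
    ∃ C : ℝ, ∀ n : Fin N → ℤ,
      (symbolAt A n ^ (τ / m)) ^ 2 ≤ C * (1 + ∑ j, (n j : ℝ) ^ 2) ^ τ := by
  obtain ⟨_, C, _, hC, h⟩ := exists_bounds_symbolAt hA
  have hm : (m : ℝ) ≠ 0 := Nat.cast_ne_zero.2 hA.order_pos.ne'
  refine ⟨(C ^ (τ / m)) ^ 2, fun n => ?_⟩
  have hle : symbolAt A n ^ (τ / m) ≤ C ^ (τ / m) * ‖n‖ ^ τ := by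
    refine (Real.rpow_le_rpow (symbolAt_nonneg hA n) (h n).2 (by positivity)).trans_eq ?_
    rw [Real.mul_rpow hC.le (by positivity), ← Real.rpow_natCast_mul (norm_nonneg _),
      mul_div_cancel₀ _ hm]
  calc (symbolAt A n ^ (τ / m)) ^ 2 ≤ (C ^ (τ / m) * ‖n‖ ^ τ) ^ 2 :=
        pow_le_pow_left₀ (Real.rpow_nonneg (symbolAt_nonneg hA n) _) hle 2
    _ = (C ^ (τ / m)) ^ 2 * (‖n‖ ^ 2) ^ τ := by
        rw [mul_pow, Real.rpow_pow_comm (norm_nonneg _)]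
    _ ≤ (C ^ (τ / m)) ^ 2 * (1 + ∑ j, (n j : ℝ) ^ 2) ^ τ := by
        gcongr
        linarith [norm_sq_le_sum_sq n]

theorem coeff_opPow (hA : IsEllipticSymbol A m) {τ : ℝ} (hτ : 0 ≤ τ) {g : L2T N}
    (hg : MemSobolev τ g) (n : Fin N → ℤ) :
    coeff (opPow A (τ / m) g) n = ((symbolAt A n ^ (τ / m) : ℝ) : ℂ) * coeff g n := by
  obtain ⟨C, hC⟩ := exists_symbolAt_rpow_sq_le hA hτ
  refine coeff_tsum_smul_expL2 ?_ n
  refine Summable.of_nonneg_of_le (fun n => by positivity) (fun n => ?_) (hg.mul_left C)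
  rw [norm_mul, mul_pow, Complex.norm_real, Real.norm_eq_abs, sq_abs, ← mul_assoc]
  gcongr
  exact hC n

theorem norm_symbolAt_rpow_smul_coeff (hA : IsEllipticSymbol A m) {τ : ℝ} (hτ : 0 ≤ τ) {g : L2T N}
    (hg : MemSobolev τ g) (ε : ℝ) {n : Fin N → ℤ} (hn : n ≠ 0) :
    ‖symbolAt A n ^ ε • coeff g n‖
      = symbolAt A n ^ (-(τ / m - ε)) * ‖coeff (opPow A (τ / m) g) n‖ := by
  have hpos := symbolAt_pos hA hn
  rw [coeff_opPow hA hτ hg, norm_smul, norm_mul, Complex.norm_real,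
    Real.norm_of_nonneg (by positivity), Real.norm_of_nonneg (by positivity), ← mul_assoc,
    ← Real.rpow_add hpos]
  congr 2
  ring

theorem unifSummableOn_coeff (hA : IsEllipticSymbol A m) {X : Type*} {K : Set X} {g : X → L2T N}
    {τ ε M : ℝ} (hτ : 0 ≤ τ) (hε : (N : ℝ) / 2 < τ - m * ε) (hg : ∀ x ∈ K, MemSobolev τ (g x))
    (hM : ∀ x ∈ K, ‖opPow A (τ / m) (g x)‖ ≤ M) :
    UnifSummableOn (fun n x => symbolAt A n ^ ε • coeff (g x) n) K := by
  classical
  intro δ hδ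
  have hm : (m : ℝ) ≠ 0 := Nat.cast_ne_zero.2 hA.order_pos.ne'
  have hsymbol : Summable fun n : Fin N → ℤ => (symbolAt A n ^ (-(τ / m - ε))) ^ 2 := by
    refine summable_symbolAt_rpow_sq hA ?_
    rw [mul_sub, mul_div_cancel₀ _ hm]
    linarith
  set B := expNorm N * |M| + 1
  have hB : 0 < B := by
    have := expNorm_pos N
    positivity
  obtain ⟨S, hS⟩ := summable_iff_vanishing_norm.1 hsymbol ((δ / B) ^ 2) (by positivity)
  refine ⟨S ∪ {0}, fun T hT x hx => ?_⟩
  rw [Finset.disjoint_union_right, Finset.disjoint_singleton_right] at hT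
  have hsymbol_le : √(∑ n ∈ T, (symbolAt A n ^ (-(τ / m - ε))) ^ 2) ≤ δ / B :=
    Real.sqrt_le_iff.2 ⟨by positivity, (Real.le_norm_self _).trans (hS T hT.1).le⟩
  have hcoeff_le : √(∑ n ∈ T, ‖coeff (opPow A (τ / m) (g x)) n‖ ^ 2) ≤ B := by
    refine Real.sqrt_le_iff.2 ⟨hB.le, (sum_sq_coeff_le _ T).trans ?_⟩
    refine pow_le_pow_left₀ (mul_nonneg (expNorm_pos N).le (norm_nonneg _)) ?_ 2
    linarith [mul_le_mul_of_nonneg_left ((hM x hx).trans (le_abs_self M)) (expNorm_pos N).le]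
  calc ∑ n ∈ T, ‖symbolAt A n ^ ε • coeff (g x) n‖
      = ∑ n ∈ T, symbolAt A n ^ (-(τ / m - ε)) * ‖coeff (opPow A (τ / m) (g x)) n‖ :=
        Finset.sum_congr rfl fun n hn => norm_symbolAt_rpow_smul_coeff hA hτ (hg x hx) ε
          fun h => hT.2 (h ▸ hn)
    _ ≤ √(∑ n ∈ T, (symbolAt A n ^ (-(τ / m - ε))) ^ 2)
          * √(∑ n ∈ T, ‖coeff (opPow A (τ / m) (g x)) n‖ ^ 2) := Real.sum_mul_le_sqrt_mul_sqrt _ _ _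
    _ ≤ δ / B * B := by gcongr
    _ = δ := div_mul_cancel₀ δ hB.ne'

theorem continuousOn_coeff (hA : IsEllipticSymbol A m) {X : Type*} [TopologicalSpace X] {K : Set X}
    {g : X → L2T N} {τ : ℝ} (hτ : 0 ≤ τ) (hg : ∀ x ∈ K, MemSobolev τ (g x))
    (hG : ContinuousOn (fun x => opPow A (τ / m) (g x)) K)
    (hg₀ : ContinuousOn (fun x => coeff (g x) 0) K) (n : Fin N → ℤ) :
    ContinuousOn (fun x => coeff (g x) n) K := by
  rcases eq_or_ne n 0 with rfl | hn
  · exact hg₀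
  · have hne : ((symbolAt A n ^ (τ / m) : ℝ) : ℂ) ≠ 0 :=
      Complex.ofReal_ne_zero.2 (Real.rpow_pos_of_pos (symbolAt_pos hA hn) _).ne'
    refine (((continuous_coeff n).comp_continuousOn hG).const_mul
      ((symbolAt A n ^ (τ / m) : ℝ) : ℂ)⁻¹).congr fun x hx => ?_
    simp only [Function.comp_apply, coeff_opPow hA hτ (hg x hx), inv_mul_cancel_left₀ hne]

end Symbol

/-! ### The problem for trigonometric series data -/

section ModeSeries

variable {N m : ℕ}

theorem UnifSummableOn.mul_expFun {X : Type*} {h : (Fin N → ℤ) → X → ℂ} {K : Set X}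
    (hh : UnifSummableOn h K) (y : X → Fin N → ℝ) :
    UnifSummableOn (fun n x => h n x * expFun n (y x)) K :=
  hh.of_norm_le fun n x _ => by rw [norm_mul, norm_expFun, mul_one]

theorem continuousOn_trigSeries {h : (Fin N → ℤ) → ℝ → ℂ} {K : Set ℝ} (hh : UnifSummableOn h K)
    (hc : ∀ n, ContinuousOn (h n) K) :
    ContinuousOn (fun p : (Fin N → ℝ) × ℝ => trigSeries (fun n => h n p.2) p.1) (univ ×ˢ K) := by
  have hsnd : MapsTo Prod.snd ((univ : Set (Fin N → ℝ)) ×ˢ K) K := fun _ hp => hp.2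
  exact ((hh.comp hsnd).mul_expFun Prod.fst).continuousOn_tsum fun n =>
    ((hc n).comp continuousOn_snd hsnd).mul
      ((continuous_expFun n).comp continuous_fst).continuousOn

theorem continuousOn_univ_prod_Ioi {X E : Type*} [TopologicalSpace X] [TopologicalSpace E]
    {g : X × ℝ → E} (h : ∀ δ T, 0 < δ → 0 < T → ContinuousOn g (univ ×ˢ Icc δ T)) :
    ContinuousOn g (univ ×ˢ Ioi 0) := by
  rintro ⟨x, t⟩ ⟨-, ht⟩
  have hnhds : univ ×ˢ Icc (t / 2) (t + 1) ∈ 𝓝 (x, t) :=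
    prod_mem_nhds univ_mem (Icc_mem_nhds (half_lt_self ht) (lt_add_one t))
  exact ((h _ _ (half_pos ht) (add_pos ht one_pos)).continuousAt hnhds).continuousWithinAt

/-- The solution of the problem with initial value `trigSeries c` and right-hand side
`trigSeries (g · t)`, solved separately for each exponential. -/
def modeSeries (A : MvPolynomial (Fin N) ℝ) (ρ : ℝ) (c : (Fin N → ℤ) → ℂ)
    (g : (Fin N → ℤ) → ℝ → ℂ) (x : Fin N → ℝ) (t : ℝ) : ℂ :=
  trigSeries (fun n => mode ρ (symbolAt A n) (c n) (g n) t) x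

variable {A : MvPolynomial (Fin N) ℝ} (hA : IsEllipticSymbol A m) {ρ : ℝ} (hρ : 0 < ρ)
  (hρ₁ : ρ ≤ 1) {c : (Fin N → ℤ) → ℂ} (hc : Summable fun n => ‖c n‖) {g : (Fin N → ℤ) → ℝ → ℂ}
  (hg : ∀ n, Continuous (g n)) (hs : UnifSummableOn g univ)

theorem modeSeries_eq_tsum_mode (A : MvPolynomial (Fin N) ℝ) (ρ : ℝ) (c : (Fin N → ℤ) → ℂ)
    (g : (Fin N → ℤ) → ℝ → ℂ) (x : Fin N → ℝ) :
    modeSeries A ρ c g x = fun t => ∑' n,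
      mode ρ (symbolAt A n) (c n * expFun n x) (fun s => g n s * expFun n x) t := by
  simp only [mode_mul]
  rfl

theorem trigSeries_modeInt_eq_tsum (A : MvPolynomial (Fin N) ℝ) (ρ : ℝ) (c : (Fin N → ℤ) → ℂ)
    (g : (Fin N → ℤ) → ℝ → ℂ) (x : Fin N → ℝ) (t : ℝ) :
    trigSeries (fun n => modeInt ρ (symbolAt A n) (c n) (g n) t) x = ∑' n,
      modeInt ρ (symbolAt A n) (c n * expFun n x) (fun s => g n s * expFun n x) t := by
  simp only [modeInt_mul]
  rfl

theorem trigSeries_modeInt_zero (A : MvPolynomial (Fin N) ℝ) {ρ : ℝ} (hρ : 0 < ρ)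
    (c : (Fin N → ℤ) → ℂ) (g : (Fin N → ℤ) → ℝ → ℂ) :
    trigSeries (fun n => modeInt ρ (symbolAt A n) (c n) (g n) 0) = trigSeries c := by
  simp only [modeInt_zero hρ]

include hA hρ hc hg hs

theorem intervalIntegrable_rlKernel_smul_modeSeries (hρ₁ : ρ < 1) (x : Fin N → ℝ) {t : ℝ}
    (ht : 0 < t) :
    IntervalIntegrable (fun s => rlKernel (1 - ρ) (t - s) • modeSeries A ρ c g x s) volume 0 t := by
  rw [modeSeries_eq_tsum_mode]
  exact (intervalIntegrable_and_hasSum_integral_mode hρ (symbolAt_nonneg hA)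
    (summable_norm_mul_expFun hc x) (fun n => (hg n).mul continuous_const)
    (hs.mul_expFun fun _ => x) hρ₁ ht).1

include hρ₁

theorem fracInt_modeSeries (x : Fin N → ℝ) {t : ℝ} (ht : 0 < t) :
    fracInt (1 - ρ) (modeSeries A ρ c g x) t
      = trigSeries (fun n => modeInt ρ (symbolAt A n) (c n) (g n) t) x := by
  rw [modeSeries_eq_tsum_mode, trigSeries_modeInt_eq_tsum]
  exact fracInt_tsum_mode hρ hρ₁ (symbolAt_nonneg hA) (summable_norm_mul_expFun hc x)
    (fun n => (hg n).mul continuous_const) (hs.mul_expFun fun _ => x) ht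

theorem continuousOn_trigSeries_modeInt {T : ℝ} (hT : 0 ≤ T) :
    ContinuousOn (fun p : (Fin N → ℝ) × ℝ =>
      trigSeries (fun n => modeInt ρ (symbolAt A n) (c n) (g n) p.2) p.1) (univ ×ˢ Icc 0 T) :=
  continuousOn_trigSeries (unifSummableOn_modeInt hρ hρ₁ (symbolAt_nonneg hA) hc hg hs hT) fun n =>
    continuousOn_modeInt hρ (symbolAt A n) (c n) (hg n) hT

theorem tendsto_fracInt_modeSeries (x : Fin N → ℝ) :
    Tendsto (fracInt (1 - ρ) (modeSeries A ρ c g x)) (𝓝[>] 0) (𝓝 (trigSeries c x)) := by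
  have hcont : ContinuousWithinAt
      (fun t => trigSeries (fun n => modeInt ρ (symbolAt A n) (c n) (g n) t) x) (Icc 0 1) 0 :=
    ((continuousOn_trigSeries_modeInt hA hρ hρ₁ hc hg hs zero_le_one).comp
      (f := fun t : ℝ => (x, t)) (by fun_prop) fun t ht => ⟨mem_univ x, ht⟩) 0
      (left_mem_Icc.2 zero_le_one)
  rw [ContinuousWithinAt, trigSeries_modeInt_zero A hρ] at hcont
  have hlim := hcont.mono_left (nhdsWithin_mono 0 Ioc_subset_Icc_self)
  rw [nhdsWithin_Ioc_eq_nhdsGT one_pos] at hlim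
  exact hlim.congr' (eventually_mem_nhdsWithin.mono fun t ht =>
    (fracInt_modeSeries hA hρ hρ₁ hc hg hs x ht).symm)

omit hs
variable {ε : ℝ} (hε : 0 < ε) (hε₁ : ε < 1)
  (hsε : UnifSummableOn (fun n s => symbolAt A n ^ ε • g n s) univ)
include hε hε₁ hsε

theorem unifSummableOn_symbolAt_smul_mode {δ T : ℝ} (hδ : 0 < δ) (hT : 0 < T) :
    UnifSummableOn (fun n t => symbolAt A n • mode ρ (symbolAt A n) (c n) (g n) t) (Icc δ T) :=
  unifSummableOn_smul_mode hρ hρ₁ (symbolAt_nonneg hA) hc hg hε hε₁ hsε hδ hT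

theorem summable_norm_symbolAt_smul_mode {t : ℝ} (ht : 0 < t) :
    Summable fun n => ‖symbolAt A n • mode ρ (symbolAt A n) (c n) (g n) t‖ :=
  (unifSummableOn_symbolAt_smul_mode hA hρ hρ₁ hc hg hε hε₁ hsε ht ht).summable ⟨le_rfl, le_rfl⟩

theorem weightSummable_mode {t : ℝ} (ht : 0 < t) :
    WeightSummable m fun n => mode ρ (symbolAt A n) (c n) (g n) t :=
  weightSummable_of_summable_symbolAt_smul hA
    (summable_norm_symbolAt_smul_mode hA hρ hρ₁ hc hg hε hε₁ hsε ht)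

theorem diffOp_modeSeries (x : Fin N → ℝ) {t : ℝ} (ht : 0 < t) :
    diffOp A (fun y => modeSeries A ρ c g y t) x
      = trigSeries (fun n => symbolAt A n • mode ρ (symbolAt A n) (c n) (g n) t) x :=
  diffOp_trigSeries hA.homogeneous (weightSummable_mode hA hρ hρ₁ hc hg hε hε₁ hsε ht) x

theorem continuousOn_trigSeries_symbolAt_smul_mode :
    ContinuousOn (fun p : (Fin N → ℝ) × ℝ =>
      trigSeries (fun n => symbolAt A n • mode ρ (symbolAt A n) (c n) (g n) p.2) p.1)
      (univ ×ˢ Ioi 0) :=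
  continuousOn_univ_prod_Ioi fun δ T hδ hT => continuousOn_trigSeries
    (unifSummableOn_symbolAt_smul_mode hA hρ hρ₁ hc hg hε hε₁ hsε hδ hT) fun n =>
      ((continuousOn_mode hρ (symbolAt A n) (c n) (hg n)).fun_const_smul _).mono
        fun t (ht : t ∈ Icc δ T) => hδ.trans_le ht.1

include hs

theorem hasDerivAt_fracInt_modeSeries (x : Fin N → ℝ) {t : ℝ} (ht : 0 < t) :
    HasDerivAt (fracInt (1 - ρ) (modeSeries A ρ c g x))
      (trigSeries (fun n => g n t) x
        - trigSeries (fun n => symbolAt A n • mode ρ (symbolAt A n) (c n) (g n) t) x) t := by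
  have hsε' : UnifSummableOn (fun n s => symbolAt A n ^ ε • (g n s * expFun n x)) univ := by
    simpa only [smul_mul_assoc] using hsε.mul_expFun fun _ => x
  have hderiv := hasDerivAt_tsum_modeInt (f := fun n s => g n s * expFun n x) hρ hρ₁
    (symbolAt_nonneg hA) (summable_norm_mul_expFun hc x) (fun n => (hg n).mul continuous_const)
    (hs.mul_expFun fun _ => x) hε hε₁ hsε' ht
  simp only [modeInt_mul, mode_mul, ← smul_mul_assoc] at hderiv
  rw [Summable.tsum_sub
    (summable_norm_mul_expFun (hs.summable (mem_univ t)) x).of_norm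
    (summable_norm_mul_expFun
      (summable_norm_symbolAt_smul_mode hA hρ hρ₁ hc hg hε hε₁ hsε ht) x).of_norm] at hderiv
  refine hderiv.congr_of_eventuallyEq ?_
  filter_upwards [Ioi_mem_nhds ht] with s hs'
  exact fracInt_modeSeries hA hρ hρ₁ hc hg hs x hs'

theorem fracDeriv_modeSeries (x : Fin N → ℝ) {T t : ℝ} (ht : t ∈ Ioc 0 T) :
    fracDeriv ρ T (modeSeries A ρ c g x) t
      = trigSeries (fun n => g n t) x
        - trigSeries (fun n => symbolAt A n • mode ρ (symbolAt A n) (c n) (g n) t) x :=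
  (hasDerivAt_fracInt_modeSeries hA hρ hρ₁ hc hg hs hε hε₁ hsε x
    ht.1).hasDerivWithinAt.derivWithin (uniqueDiffOn_Ioc 0 T t ht)

theorem isRegularSolution_modeSeries {T : ℝ} (hT : 0 ≤ T) :
    IsRegularSolution A m ρ T (trigSeries c) (fun x t => trigSeries (fun n => g n t) x)
      (modeSeries A ρ c g) := by
  have hΛ := (continuousOn_trigSeries_symbolAt_smul_mode hA hρ hρ₁ hc hg hε hε₁ hsε).mono
    (prod_mono_right fun t (ht : t ∈ Ioc 0 T) => ht.1)
  have hdiffOp (x : Fin N → ℝ) {t : ℝ} (ht : t ∈ Ioc 0 T) :=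
    diffOp_modeSeries hA hρ hρ₁ hc hg hε hε₁ hsε x ht.1
  have hfracDeriv (x : Fin N → ℝ) {t : ℝ} (ht : t ∈ Ioc 0 T) :=
    fracDeriv_modeSeries hA hρ hρ₁ hc hg hs hε hε₁ hsε x ht
  exact
    { periodic := fun t _ => isPeriodic_trigSeries _
      contDiff := fun t ht =>
        contDiff_trigSeries m (weightSummable_mode hA hρ hρ₁ hc hg hε hε₁ hsε ht.1)
      continuous_diffOp := hΛ.congr fun p hp => hdiffOp p.1 hp.2
      integrable := fun hρ₁' x t ht => by
        have hΓ : Real.Gamma (1 - ρ) ≠ 0 := (Real.Gamma_pos_of_pos (sub_pos.2 hρ₁')).ne'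
        refine ((intervalIntegrable_rlKernel_smul_modeSeries hA hρ hc hg hs hρ₁' x ht.1).smul
          (Real.Gamma (1 - ρ))).congr fun s _ => ?_
        rw [Pi.smul_apply, smul_smul, rlKernel, mul_div_cancel₀ _ hΓ, Complex.real_smul]
      continuous_fracInt := ⟨_, continuousOn_trigSeries_modeInt hA hρ hρ₁ hc hg hs hT,
        fun x t ht => (fracInt_modeSeries hA hρ hρ₁ hc hg hs x ht.1).symm⟩
      differentiable := fun x t ht => (hasDerivAt_fracInt_modeSeries hA hρ hρ₁ hc hg hs hε hε₁ hsε x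
        ht.1).differentiableAt.differentiableWithinAt
      continuous_fracDeriv :=
        (((continuousOn_trigSeries hs fun n => (hg n).continuousOn).mono
          (prod_mono_right (subset_univ _))).sub hΛ).congr fun p hp => hfracDeriv p.1 hp.2
      equation := fun x t ht => by rw [hfracDeriv x ht, hdiffOp x ht, sub_add_cancel]
      initial := tendsto_fracInt_modeSeries hA hρ hρ₁ hc hg hs }

end ModeSeries

/-! ### Sobolev data -/

section SobolevData

variable {N m : ℕ}

theorem exists_mem_Ioo_lt_sub_mul {a b : ℝ} (hab : a < b) (r : ℝ) :
    ∃ ε ∈ Ioo (0 : ℝ) 1, a < b - r * ε := by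
  have hlim : Tendsto (fun ε => b - r * ε) (𝓝[>] 0) (𝓝 b) :=
    (Continuous.tendsto' (by fun_prop) 0 b (by simp)).mono_left nhdsWithin_le_nhds
  have hmem : ∀ᶠ ε in 𝓝[>] (0 : ℝ), ε ∈ Ioo 0 1 := Ioo_mem_nhdsGT one_pos
  exact (hmem.and (hlim.eventually (lt_mem_nhds hab))).exists

theorem trigSeries_coeff_of_memSobolev {τ : ℝ} (hτ : (N : ℝ) / 2 < τ) {g : L2T N}
    (hg : MemSobolev τ g) :
    Continuous (trigSeries (coeff g)) ∧ IsPeriodic (trigSeries (coeff g)) ∧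
      trigSeries (coeff g) =ᵐ[torusMeasure N] g :=
  have hsum := summable_norm_coeff hτ hg
  ⟨continuous_trigSeries hsum, isPeriodic_trigSeries _, ae_eq_tsum_coeff_mul_expFun g hsum⟩

/-- The Fourier coefficients of `f`, extended from `[0, T]` to the line by constants, so that the
causal convolutions are taken of functions that are continuous everywhere. -/
def extCoeff {T : ℝ} (hT : 0 ≤ T) (f : ℝ → L2T N) (n : Fin N → ℤ) (t : ℝ) : ℂ :=
  coeff (f (projIcc 0 T hT t)) n

variable {T : ℝ} (hT : 0 ≤ T) {f : ℝ → L2T N}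

theorem extCoeff_of_mem (f : ℝ → L2T N) {t : ℝ} (ht : t ∈ Icc 0 T) :
    (fun n => extCoeff hT f n t) = coeff (f t) := by
  ext n
  rw [extCoeff, projIcc_of_mem hT ht]

theorem continuous_extCoeff {n : Fin N → ℤ} (hf : ContinuousOn (fun t => coeff (f t) n) (Icc 0 T)) :
    Continuous (extCoeff hT f n) :=
  hf.comp_continuous (continuous_subtype_val.comp continuous_projIcc) fun t => (projIcc 0 T hT t).2

theorem unifSummableOn_extCoeff {A : MvPolynomial (Fin N) ℝ} (hA : IsEllipticSymbol A m) {τ ε : ℝ}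
    (hτ : 0 ≤ τ) (hf : ∀ t ∈ Icc 0 T, MemSobolev τ (f t))
    (hF : ContinuousOn (fun t => opPow A (τ / m) (f t)) (Icc 0 T))
    (hε : (N : ℝ) / 2 < τ - m * ε) :
    UnifSummableOn (fun n t => symbolAt A n ^ ε • extCoeff hT f n t) univ := by
  obtain ⟨M, hM⟩ := isCompact_Icc.exists_bound_of_continuousOn hF
  exact (unifSummableOn_coeff hA hτ hε hf hM).comp (p := fun t => (projIcc 0 T hT t : ℝ))
    fun t _ => (projIcc 0 T hT t).2

theorem duhamelIntegrand_eq (A : MvPolynomial (Fin N) ℝ) (ρ : ℝ) (f : ℝ → L2T N)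
    (n : Fin N → ℤ) {t ξ : ℝ} (ht : t ≤ T) (hξ : ξ ∈ Icc 0 t) :
    duhamelIntegrand A ρ f n t ξ = mlKernel ρ (symbolAt A n) ξ • extCoeff hT f n (t - ξ) := by
  have hmem : t - ξ ∈ Icc 0 T := ⟨sub_nonneg.2 hξ.2, (sub_le_self t hξ.1).trans ht⟩
  rw [duhamelIntegrand, congrFun (extCoeff_of_mem hT f hmem) n, Complex.real_smul, mul_comm,
    mlKernel]

theorem solCoeff_eq_mode (A : MvPolynomial (Fin N) ℝ) (ρ : ℝ) (φ : L2T N) (f : ℝ → L2T N)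
    (n : Fin N → ℤ) {t : ℝ} (ht : t ∈ Icc 0 T) :
    solCoeff A ρ φ f n t = mode ρ (symbolAt A n) (coeff φ n) (extCoeff hT f n) t := by
  rw [solCoeff, mode, causalConv, Complex.real_smul, mul_comm, mlKernel]
  congr 1
  refine intervalIntegral.integral_congr fun ξ hξ => ?_
  rw [uIcc_of_le ht.1] at hξ
  exact duhamelIntegrand_eq hT A ρ f n ht.2 hξ

include hT in
theorem intervalIntegrable_duhamelIntegrand (A : MvPolynomial (Fin N) ℝ) {ρ : ℝ} (hρ : 0 < ρ)
    {n : Fin N → ℤ} (hf : ContinuousOn (fun t => coeff (f t) n) (Icc 0 T)) {t : ℝ}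
    (ht : t ∈ Ioc 0 T) : IntervalIntegrable (duhamelIntegrand A ρ f n t) volume 0 t := by
  refine (intervalIntegrable_smul_comp_sub (s := t)
    (intervalIntegrable_mlKernel hρ (symbolAt A n) ht.1) (continuous_extCoeff hT hf)).congr
      fun ξ hξ => ?_
  rw [uIoc_of_le ht.1.le] at hξ
  exact (duhamelIntegrand_eq hT A ρ f n ht.2 (Ioc_subset_Icc_self hξ)).symm

end SobolevData

end

end TorusSubdiffusion

open TorusSubdiffusion

theorem theorem3 {N m : ℕ} (A : MvPolynomial (Fin N) ℝ) (hA : IsEllipticSymbol A m)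
    (ρ : ℝ) (hρ₀ : 0 < ρ) (hρ₁ : ρ ≤ 1) (T : ℝ) (hT : 0 < T)
    (τ : ℝ) (hτ : (N : ℝ) / 2 < τ)
    (φ : L2T N) (hφ : MemSobolev τ φ)
    (f : ℝ → L2T N) (hf : ∀ t ∈ Set.Icc 0 T, MemSobolev τ (f t))
    (hF : ContinuousOn (fun t => opPow A (τ / m) (f t)) (Set.Icc 0 T))
    -- `A(0) = 0`, so `hF` does not see the mean value of `f(·,t)`
    (hf₀ : ContinuousOn (fun t => coeff (f t) 0) (Set.Icc 0 T)) :
    -- the continuous periodic representatives of the data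
    ∃ (φc : (Fin N → ℝ) → ℂ) (fc : (Fin N → ℝ) → ℝ → ℂ) (u : (Fin N → ℝ) → ℝ → ℂ),
      (Continuous φc ∧ IsPeriodic φc ∧ φc =ᵐ[torusMeasure N] φ) ∧
      (∀ t ∈ Set.Icc 0 T, Continuous (fun x => fc x t) ∧ IsPeriodic (fun x => fc x t) ∧
        (fun x => fc x t) =ᵐ[torusMeasure N] f t) ∧
      IsRegularSolution A m ρ T φc fc u ∧
      ∀ t ∈ Set.Ioc 0 T,
        (∀ n, IntervalIntegrable (duhamelIntegrand A ρ f n t) MeasureTheory.volume 0 t) ∧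
        (∀ x, Summable fun n => ‖solCoeff A ρ φ f n t * expFun n x‖) ∧
        TendstoUniformly
          (fun (s : Finset (Fin N → ℤ)) x => ∑ n ∈ s, solCoeff A ρ φ f n t * expFun n x)
          (fun x => u x t) Filter.atTop := by
  have hτ₀ : 0 ≤ τ := le_trans (by positivity) hτ.le
  obtain ⟨ε, ⟨hε, hε₁⟩, hετ⟩ := exists_mem_Ioo_lt_sub_mul hτ m
  have hcoeff := continuousOn_coeff hA hτ₀ hf hF hf₀
  have hcont := fun n => continuous_extCoeff hT.le (hcoeff n)
  have hsum : UnifSummableOn (extCoeff hT.le f) Set.univ := by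
    simpa using unifSummableOn_extCoeff hT.le hA hτ₀ hf hF (ε := 0) (by simpa using hτ)
  have hsumε := unifSummableOn_extCoeff hT.le hA hτ₀ hf hF hετ
  have hφ_sum := summable_norm_coeff hτ hφ
  refine ⟨trigSeries (coeff φ), fun x t => trigSeries (fun n => extCoeff hT.le f n t) x,
    modeSeries A ρ (coeff φ) (extCoeff hT.le f), trigSeries_coeff_of_memSobolev hτ hφ,
    fun t ht => ?_,
    isRegularSolution_modeSeries hA hρ₀ hρ₁ hφ_sum hcont hsum hε hε₁ hsumε hT.le,
    fun t ht => ⟨fun n => intervalIntegrable_duhamelIntegrand hT.le A hρ₀ (hcoeff n) ht, ?_⟩⟩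
  · simpa only [extCoeff_of_mem hT.le f ht] using trigSeries_coeff_of_memSobolev hτ (hf t ht)
  · simp only [solCoeff_eq_mode hT.le A ρ φ f _ (Set.Ioc_subset_Icc_self ht)]
    have hmode := summable_norm_mode hρ₀ hρ₁ (symbolAt_nonneg hA) hφ_sum hcont hsum ht.1
    exact ⟨summable_norm_mul_expFun hmode,
      tendstoUniformly_tsum hmode fun n x => by rw [norm_mul, norm_expFun, mul_one]⟩
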